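/- Consider $N$ system qubits $1,\dots,N$ on an open line and $N$ ancilla qubits $1,\dots,N$. There are three kinds of layers of two-qubit gates: the \emph{ancilla layer} has one gate on each pair (system qubit $j$, ancilla $j$); the \emph{odd layer} has one gate on each pair $(2j-1,2j)$ of system qubits; the \emph{even layer} has one gate on each pair $(2j,2j+1)$ of system qubits. The gate on a pair $e$ in iteration $t$ is $e^{-i\sum_Q\theta_{t,e,Q}Q}$, where $Q$ runs over the 15 non-identity Pauli operators on the pair, and $U_t(\vec\theta)=e^{-i\sum_{e,Q}\theta_{t,e,Q}Q}$ is the unitary of the whole layer. The circuit rotates among the three kinds of layers: any three consecutive iterations use three different kinds. Starting from an arbitrary state $\rho_0$ of the system, iteration $t$ maps $\rho\mapsto\operatorname{Tr}_A\big[U_t(\vec\theta)\,(|0\rangle\langle 0|_A\otimes\rho)\,U_t(\vec\theta)^\dagger\big]$, i.e. all ancillas are reset to $|0\rangle$ in each iteration. Let $\rho(\vec\theta)$ be the state of the system after $T$ iterations, where $T$ is such that at least one of them is an ancilla layer (as is automatic for $T\ge 3$). Let the parameters $\vec\theta$ be random such that the two-qubit gates are independent and each of them is distributed by the Haar measure of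 $\mathrm{SU}(4)$. For a system qubit $j$, let $f_j$ be the least number of layers that separate a single-qubit observable on qubit $j$ at the end of the circuit from a reset of an ancilla inside its backward light cone, and let $f=\max_j f_j$. Let $H$ be a $k$-local Hamiltonian on the system, i.e. a sum of Hermitian terms each acting on at most $k$ qubits, let $H_0=H-\frac{\operatorname{Tr}H}{2^N}I$ be its traceless part (so $H_0=H$ if $H$ is traceless), and let $\|A\|_{\mathrm{HS}}=\sqrt{\operatorname{Tr}(A^\dagger A)/2^N}$ be the normalized Hilbert--Schmidt norm. Then \[ f\le 5\qquad\text{and}\qquad \mathrm{Var}_{\vec\theta}\big[\operatorname{Tr}(H\rho(\vec\theta))\big]\;\ge\;\frac{\|H_0\|_{\mathrm{HS}}^2}{5^{k(f+1)}} . \] Consequently $\mathrm{Var}_{\vec\theta}[\operatorname{Tr}(H\rho(\vec\theta))]\ge \|H_0\|_{\mathrm{HS}}^2/5^{6k}$, with a constant that does not depend on $N$ or $T$. -/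

import Mathlib

noncomputable section

namespace SSGD

open scoped ComplexOrder

/-- Operators on a register of qubits indexed by `Q`, in the computational basis `Q → Fin 2`. -/
abbrev Op (Q : Type) : Type := Matrix (Q → Fin 2) (Q → Fin 2) ℂ

/-- The single-qubit Pauli matrices `I, X, Y, Z`. -/
def pauli : Fin 4 → Matrix (Fin 2) (Fin 2) ℂ :=
  ![1, !![0, 1; 1, 0], !![0, -Complex.I; Complex.I, 0], !![1, 0; 0, -1]]

/-- The Pauli operator `⨂_q pauli (s q)` on a register `Q`. -/
def pauliString {Q : Type} [Fintype Q] (s : Q → Fin 4) : Op Q :=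
  Matrix.of fun x y => ∏ q, pauli (s q) (x q) (y q)

/-- The labels of the 15 non-identity Pauli operators on two qubits. -/
abbrev PauliPair : Type := {p : Fin 4 × Fin 4 // p ≠ (0, 0)}

/-- The two-qubit gate `exp(-i ∑_P θ_P P)`, the sum being over the non-identity Pauli operators
on two qubits. -/
def twoQubitGate (θ : PauliPair → ℝ) : Op (Fin 2) :=
  NormedSpace.exp ((-Complex.I) •
    ∑ p : PauliPair, (θ p : ℂ) • pauliString ![p.1.1, p.1.2])

/-! ### Haar measure on `SU(4)` -/

instance : MeasurableSpace (Op (Fin 2)) := borel _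

instance : BorelSpace (Op (Fin 2)) := ⟨rfl⟩

/-- `SU(4)`, acting on two qubits. -/
abbrev SU4 : Submonoid (Op (Fin 2)) := Matrix.specialUnitaryGroup (Fin 2 → Fin 2) ℂ

instance : IsTopologicalGroup SU4 where
  continuous_mul := by fun_prop
  continuous_inv := Continuous.subtype_mk (continuous_star.comp continuous_subtype_val) _

instance : CompactSpace SU4 := by
  have hclosed : IsClosed (SU4 : Set (Op (Fin 2))) := by
    have h : (SU4 : Set (Op (Fin 2))) = {A | A * star A = 1} ∩ {A | A.det = 1} := by
      ext A
      rw [SetLike.mem_coe, Matrix.mem_specialUnitaryGroup_iff, Matrix.mem_unitaryGroup_iff]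
      rfl
    rw [h]
    exact (isClosed_eq (continuous_id.mul continuous_star) continuous_const).inter
      (isClosed_eq (Continuous.matrix_det continuous_id) continuous_const)
  have hcompact : IsCompact (Set.univ.pi fun _ : Fin 2 → Fin 2 =>
      Set.univ.pi fun _ : Fin 2 → Fin 2 => Metric.closedBall (0 : ℂ) 1) :=
    isCompact_univ_pi fun _ => isCompact_univ_pi fun _ => isCompact_closedBall _ _
  refine isCompact_iff_compactSpace.mp (hcompact.of_isClosed_subset hclosed fun A hA => ?_)
  intro i _ j _
  simpa using entry_norm_bound_of_unitary (Matrix.specialUnitaryGroup_le_unitaryGroup hA) i j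

/-- The Haar probability measure of `SU(4)`. -/
def haarSU4 : MeasureTheory.Measure SU4 :=
  MeasureTheory.Measure.haarMeasure ⊤

/-! ### The brickwall circuit with ancillas -/

/-- `Sum.inl j` is the `j`th system qubit, `Sum.inr j` is the `j`th ancilla. -/
abbrev Qubit (N : ℕ) : Type := Fin N ⊕ Fin N

/-- The three sets of generators among which the circuit rotates. -/
inductive LayerKind
  /-- pairs formed by the `j`th system qubit and the `j`th ancilla -/
  | ancilla
  /-- pairs of system qubits `(1,2), (3,4), …` -/
  | odd
  /-- pairs of system qubits `(2,3), (4,5), …` -/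
  | even

/-- The pairs of qubits on which the two-qubit gates of a layer act. (Positions in `Fin N` are
counted from `0`, so the pairs `(2j-1, 2j)` are those whose first position is even.) -/
def gates (N : ℕ) : LayerKind → Finset (Qubit N × Qubit N)
  | .ancilla => Finset.univ.image fun j => (Sum.inl j, Sum.inr j)
  | .odd => (Finset.univ.filter fun p : Fin N × Fin N =>
      Even p.1.val ∧ p.2.val = p.1.val + 1).image fun p => (Sum.inl p.1, Sum.inl p.2)
  | .even => (Finset.univ.filter fun p : Fin N × Fin N =>
      Odd p.1.val ∧ p.2.val = p.1.val + 1).image fun p => (Sum.inl p.1, Sum.inl p.2)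

/-- The schedule `σ` (`σ t` is the kind of the layer applied in iteration `t`) rotates among the
three kinds. -/
def IsRotation (σ : ℕ → LayerKind) : Prop :=
  ∀ t, σ t ≠ σ (t + 1) ∧ σ (t + 1) ≠ σ (t + 2) ∧ σ t ≠ σ (t + 2)

/-- The Pauli operator of the full register acting as `p` on the pair `e` of qubits. -/
def pairPauli {N : ℕ} (e : Qubit N × Qubit N) (p : PauliPair) : Op (Qubit N) :=
  pauliString (Function.update (Function.update (fun _ => 0) e.1 p.1.1) e.2 p.1.2)

/-- Parameters of one iteration: a real number for each generator. -/
abbrev LayerParams (N : ℕ) : Type := Qubit N × Qubit N → PauliPair → ℝ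

/-- `U(θ) = exp(-i θ·P)`, with `P` running over the generators of the layer. -/
def layerUnitary {N : ℕ} (κ : LayerKind) (θ : LayerParams N) : Op (Qubit N) :=
  NormedSpace.exp ((-Complex.I) •
    ∑ e ∈ gates N κ, ∑ p : PauliPair, (θ e p : ℂ) • pairPauli e p)

/-- `|0⟩⟨0|_A ⊗ ρ`. -/
def attachAncillas {N : ℕ} (ρ : Op (Fin N)) : Op (Qubit N) :=
  Matrix.of fun x y =>
    if (∀ j, x (Sum.inr j) = 0) ∧ ∀ j, y (Sum.inr j) = 0 then
      ρ (fun j => x (Sum.inl j)) (fun j => y (Sum.inl j))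
    else 0

/-- The partial trace `Tr_A` over the ancillas. -/
def traceAncillas {N : ℕ} (M : Op (Qubit N)) : Op (Fin N) :=
  Matrix.of fun x y => ∑ a : Fin N → Fin 2, M (Sum.elim x a) (Sum.elim y a)

/-- Density operators. -/
def IsDensity {Q : Type} [Fintype Q] [DecidableEq Q] (ρ : Op Q) : Prop :=
  ρ.PosSemidef ∧ ρ.trace = 1

/-- One iteration: with the ancillas reset to `|0⟩`, apply the layer and discard the ancillas. -/
def iteration {N : ℕ} (κ : LayerKind) (θ : LayerParams N) (ρ : Op (Fin N)) : Op (Fin N) :=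
  traceAncillas
    (layerUnitary κ θ * attachAncillas ρ * (layerUnitary κ θ).conjTranspose)

/-- The state `ρ(θ)` of the system after `T` iterations started from `ρ₀`. -/
def outputState {N : ℕ} (σ : ℕ → LayerKind) (ρ₀ : Op (Fin N)) (θ : ℕ → LayerParams N) :
    ℕ → Op (Fin N)
  | 0 => ρ₀
  | T + 1 => iteration (σ T) (θ T) (outputState σ ρ₀ θ T)

/-- The energy `Tr(H ρ(θ))` after `T` iterations. -/
def energy {N : ℕ} (σ : ℕ → LayerKind) (T : ℕ) (ρ₀ H : Op (Fin N)) (θ : ℕ → LayerParams N) : ℝ :=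
  (H * outputState σ ρ₀ θ T).trace.re

/-- The two-qubit gates of the first `T` iterations: iteration and pair of qubits. -/
abbrev GateIndex (N : ℕ) (σ : ℕ → LayerKind) (T : ℕ) : Type :=
  {i : ℕ × (Qubit N × Qubit N) // i.1 < T ∧ i.2 ∈ gates N (σ i.1)}

/-- Random parameters `θ` for which the two-qubit gates of the first `T` iterations are
independent, each distributed by the Haar measure of `SU(4)`. -/
structure IsHaarRandom {Ω : Type*} [MeasurableSpace Ω] (P : MeasureTheory.Measure Ω) {N : ℕ}
    (σ : ℕ → LayerKind) (T : ℕ) (θ : Ω → ℕ → LayerParams N) : Prop where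
  haar : ∀ i : GateIndex N σ T, ProbabilityTheory.HasLaw
    (fun ω => twoQubitGate (θ ω i.1.1 i.1.2)) (haarSU4.map Subtype.val) P
  indep : ProbabilityTheory.iIndepFun
    (fun (i : GateIndex N σ T) ω => twoQubitGate (θ ω i.1.1 i.1.2)) P

/-! ### Distance to the nearest reset inside the light cone -/

/-- The qubits that can influence the qubits in `C` through a layer of kind `κ`. -/
def backward {N : ℕ} (κ : LayerKind) (C : Finset (Qubit N)) : Finset (Qubit N) :=
  C ∪ ((gates N κ).filter fun e => e.1 ∈ C ∨ e.2 ∈ C).biUnion fun e => {e.1, e.2}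

/-- The system qubits in the backward light cone of the `j`th system qubit, `d` layers before the
end of a circuit with `T` layers. (The light cone does not continue through a reset ancilla.) -/
def lightCone {N : ℕ} (σ : ℕ → LayerKind) (T : ℕ) (j : Fin N) : ℕ → Finset (Qubit N)
  | 0 => {Sum.inl j}
  | d + 1 => (backward (σ (T - 1 - d)) (lightCone σ T j d)).filter fun q => q.isLeft = true

/-- The least number of layers between a single-qubit observable on the `j`th system qubit at the
end of the circuit and a reset of an ancilla inside its light cone. The reset that precedes the
layer of iteration `T - 1 - d` is separated from the end by `d + 1` layers. -/
def resetDistance {N : ℕ} (σ : ℕ → LayerKind) (T : ℕ) (j : Fin N) : ℕ :=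
  sInf {n | ∃ d < T, n = d + 1 ∧
    ∃ a : Fin N, Sum.inr a ∈ backward (σ (T - 1 - d)) (lightCone σ T j d)}

/-- The distance `f` from an observable to the nearest reset in its light cone (the largest value
over all positions of the observable). -/
def feedforwardDistance (N : ℕ) (σ : ℕ → LayerKind) (T : ℕ) : ℕ :=
  Finset.univ.sup fun j : Fin N => resetDistance σ T j

/-! ### Hamiltonians -/

/-- `A = B ⊗ 1` with `B` an operator on the qubits in `S`. -/
def ActsOn {Q : Type} [Fintype Q] [DecidableEq Q] (S : Finset Q) (A : Op Q) : Prop :=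
  ∃ B : Op {q // q ∈ S}, ∀ x y, A x y =
    if ∀ q, q ∉ S → x q = y q then B (fun q => x q.1) (fun q => y q.1) else 0

/-- A `k`-local Hamiltonian: a sum of Hermitian terms each acting on at most `k` qubits. -/
def IsLocalHamiltonian {Q : Type} [Fintype Q] [DecidableEq Q] (k : ℕ) (H : Op Q) : Prop :=
  ∃ h : Finset Q → Op Q,
    (∀ S, S.card ≤ k → (h S).IsHermitian ∧ ActsOn S (h S)) ∧
    H = ∑ S with S.card ≤ k, h S

/-- The normalized Hilbert–Schmidt norm `√(Tr(A†A) / 2^n)` on `n` qubits. -/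
def hsNorm {Q : Type} [Fintype Q] [DecidableEq Q] (A : Op Q) : ℝ :=
  Real.sqrt ((A.conjTranspose * A).trace.re / 2 ^ Fintype.card Q)

/-- `A - (Tr A / 2^n) 1` on `n` qubits; equal to `A` if `A` is traceless. -/
def tracelessPart {Q : Type} [Fintype Q] [DecidableEq Q] (A : Op Q) : Op Q :=
  A - (A.trace / 2 ^ Fintype.card Q) • 1

end SSGD

end

set_option linter.unusedSectionVars false

noncomputable section

namespace SSGD

open Matrix Finset
open scoped Kronecker

section PauliAlgebra

/-! ### Pauli strings -/

/-! The proof follows the second moments E[⟨P⟩⟨P'⟩] of the Pauli expectations of the random state. A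
two-qubit gate `V` acts on Pauli expectations through a real matrix, `transfer V`, which fixes the
identity and is orthogonal on the other 15 strings of the pair. Averaging over the Haar measure
gives E[R_pq R_p'q'] = δ_pp' δ_qq' / 15 for nonzero p and p' (`twirlMoment_of_ne`,
`twirlMoment_of_ne_zero`). Hence after a gate, strings that differ on its pair are uncorrelated, and
the moment of a string that is nontrivial there becomes the mean over the 15 nontrivial strings on
the pair (`moment_onPair`).

A layer with disjoint pairs therefore preserves lower bounds of product form (`moment_conjPairs`),
in particular the bound a^|P| with |P| the number of non-identity factors. The last ancilla layer
touches every system qubit, so it removes all correlations whatever the earlier state was. It gives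
a = 1/15, because the mean contains the string I⊗Z, whose expectation in the reset ancilla is 1
(`momentBound_ancilla_layer`). Each later layer costs at most a factor 5
(`MomentBound.system_layer`), and the rotation allows at most d = 2 of them.

With H = ∑ c_P P the variance is then the diagonal sum of c_P² E[⟨P⟩²] over P ≠ I, which is at least
a^k ‖H₀‖² by locality (`pow_mul_hsNorm_le_variance`). Finally f = d + 1 (`resetDistance_eq`) and
15·5^d ≤ 5^(d+2) = 5^(f+1). -/

lemma pauli_mul_self (i : Fin 4) : pauli i * pauli i = 1 := by
  fin_cases i <;> ext a b <;> fin_cases a <;> fin_cases b <;> simp [pauli, Matrix.mul_apply]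

lemma pauli_conjTranspose (i : Fin 4) : (pauli i)ᴴ = pauli i := by
  fin_cases i <;> ext a b <;> fin_cases a <;> fin_cases b <;> simp [pauli]

lemma pauli_trace (i : Fin 4) : (pauli i).trace = if i = 0 then 2 else 0 := by
  fin_cases i <;> simp [pauli, Matrix.trace]

lemma pauli_zero : pauli 0 = 1 := rfl

/-- The sign by which two Pauli matrices commute. -/
def pauliSign (i j : Fin 4) : ℤ := if i = 0 ∨ j = 0 ∨ i = j then 1 else -1

lemma pauli_mul_comm (i j : Fin 4) :
    pauli i * pauli j = (pauliSign i j : ℂ) • (pauli j * pauli i) := by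
  fin_cases i <;> fin_cases j <;> ext a b <;> fin_cases a <;> fin_cases b <;>
    simp [pauli, pauliSign, Matrix.mul_apply]

/-- This is the identity ∑ P ⊗ P = 2·SWAP in coordinates; it makes the Pauli strings a basis of the
operators. -/
lemma pauli_completeness (a b c d : Fin 2) :
    ∑ i, pauli i a b * pauli i c d = if a = d ∧ b = c then 2 else 0 := by
  fin_cases a <;> fin_cases b <;> fin_cases c <;> fin_cases d <;>
    simp [pauli, Fin.sum_univ_four] <;> norm_num

variable {Q : Type} [Fintype Q]

lemma pauliString_zero : pauliString (0 : Q → Fin 4) = 1 := by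
  ext x y
  simp only [pauliString, Pi.zero_apply, pauli_zero, Matrix.of_apply, Matrix.one_apply]
  by_cases h : x = y
  · simp [h]
  · obtain ⟨q, hq⟩ := Function.ne_iff.mp h
    rw [if_neg h]
    exact Finset.prod_eq_zero (Finset.mem_univ q) (if_neg hq)

lemma pauliString_conjTranspose (s : Q → Fin 4) : (pauliString s)ᴴ = pauliString s := by
  ext x y
  simp only [pauliString, Matrix.conjTranspose_apply, Matrix.of_apply, star_prod]
  refine Finset.prod_congr rfl fun q _ => ?_
  conv_rhs => rw [← pauli_conjTranspose]
  rfl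

variable [DecidableEq Q]

lemma of_prod_mul_of_prod (M M' : Q → Matrix (Fin 2) (Fin 2) ℂ) :
    (Matrix.of fun x y => ∏ q, M q (x q) (y q) : Op Q) * (Matrix.of fun x y => ∏ q, M' q (x q) (y q))
      = Matrix.of fun x y => ∏ q, (M q * M' q) (x q) (y q) := by
  ext x y
  simp only [Matrix.mul_apply, Matrix.of_apply, Finset.prod_univ_sum, Fintype.piFinset_univ,
    Finset.prod_mul_distrib]

lemma pauliString_mul_self (s : Q → Fin 4) : pauliString s * pauliString s = 1 := by
  rw [pauliString, of_prod_mul_of_prod, ← pauliString_zero]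
  simp only [pauli_mul_self, pauliString, Pi.zero_apply, pauli_zero]

lemma pauliString_mul_comm (s t : Q → Fin 4) :
    pauliString s * pauliString t =
      ((∏ q, pauliSign (s q) (t q) : ℤ) : ℂ) • (pauliString t * pauliString s) := by
  simp only [pauliString, of_prod_mul_of_prod]
  ext x y
  simp only [Matrix.of_apply, Matrix.smul_apply, pauli_mul_comm (s _), smul_eq_mul,
    Finset.prod_mul_distrib, Int.cast_prod]

lemma trace_pauliString (s : Q → Fin 4) :
    (pauliString s).trace = if s = 0 then 2 ^ Fintype.card Q else 0 := by
  have h : (pauliString s).trace = ∏ q, (pauli (s q)).trace := by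
    simp only [Matrix.trace, pauliString, Matrix.diag_apply, Matrix.of_apply,
      Finset.prod_univ_sum, Fintype.piFinset_univ]
  rw [h]
  simp only [pauli_trace]
  split_ifs with hs
  · simp [hs]
  · obtain ⟨q, hq⟩ := Function.ne_iff.mp hs
    exact Finset.prod_eq_zero (Finset.mem_univ q) (if_neg hq)

lemma pauliString_completeness (x y z w : Q → Fin 2) :
    ∑ s : Q → Fin 4, pauliString s x y * pauliString s z w =
      if x = w ∧ y = z then 2 ^ Fintype.card Q else 0 := by
  have h : ∑ s : Q → Fin 4, pauliString s x y * pauliString s z w =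
      ∏ q, ∑ i, pauli i (x q) (y q) * pauli i (z q) (w q) := by
    simp only [pauliString, Matrix.of_apply, ← Finset.prod_mul_distrib,
      Finset.prod_univ_sum, Fintype.piFinset_univ]
  rw [h]
  simp only [pauli_completeness]
  split_ifs with hs
  · simp [hs.1, hs.2]
  · have : ∃ q, ¬ (x q = w q ∧ y q = z q) := by
      by_contra hc
      push Not at hc
      exact hs ⟨funext fun q => (hc q).1, funext fun q => (hc q).2⟩
    obtain ⟨q, hq⟩ := this
    exact Finset.prod_eq_zero (Finset.mem_univ q) (if_neg hq)

/-- Expansion of an operator in Pauli strings. -/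
lemma sum_trace_smul_pauliString (A : Op Q) :
    ∑ s : Q → Fin 4, ((pauliString s * A).trace / 2 ^ Fintype.card Q) • pauliString s = A := by
  ext x y
  have h : ∀ s : Q → Fin 4, ((pauliString s * A).trace / 2 ^ Fintype.card Q) * pauliString s x y =
      ∑ z, ∑ w, (A w z / 2 ^ Fintype.card Q) * (pauliString s z w * pauliString s x y) := by
    intro s
    simp only [Matrix.trace, Matrix.diag_apply, Matrix.mul_apply, Finset.sum_div, Finset.sum_mul]
    exact Finset.sum_congr rfl fun _ _ => Finset.sum_congr rfl fun _ _ => by ring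
  simp only [Matrix.sum_apply, Matrix.smul_apply, smul_eq_mul, h]
  rw [Finset.sum_comm]
  simp_rw [Finset.sum_comm (s := (Finset.univ : Finset (Q → Fin 4))), ← Finset.mul_sum,
    pauliString_completeness]
  simp [ite_and]

lemma trace_pauliString_mul_pauliString (s t : Q → Fin 4) :
    (pauliString s * pauliString t).trace = if s = t then 2 ^ Fintype.card Q else 0 := by
  split_ifs with h
  · rw [h, pauliString_mul_self]; simp [Matrix.trace]
  · have : ∃ q, s q ≠ t q := Function.ne_iff.mp h
    obtain ⟨q, hq⟩ := this
    have h1 : (pauliString s * pauliString t).trace = ∏ q, (pauli (s q) * pauli (t q)).trace := by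
      simp only [pauliString, of_prod_mul_of_prod]
      simp only [Matrix.trace, Matrix.diag_apply, Matrix.of_apply,
        Finset.prod_univ_sum, Fintype.piFinset_univ]
    rw [h1]
    refine Finset.prod_eq_zero (Finset.mem_univ q) ?_
    revert hq
    generalize s q = i
    generalize t q = j
    fin_cases i <;> fin_cases j <;> simp [pauli, Matrix.trace]

/-- The real part of the expectation of a Pauli string. -/
def pauliExp (s : Q → Fin 4) (A : Op Q) : ℝ := (pauliString s * A).trace.re

lemma trace_pauliString_mul_of_isHermitian (s : Q → Fin 4) {A : Op Q} (hA : A.IsHermitian) :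
    (pauliString s * A).trace = (pauliExp s A : ℂ) := by
  have h : star (pauliString s * A).trace = (pauliString s * A).trace := by
    rw [← Matrix.trace_conjTranspose, Matrix.conjTranspose_mul, hA.eq, pauliString_conjTranspose,
      Matrix.trace_mul_comm]
  exact (Complex.conj_eq_iff_re.mp h).symm

/-- The real Pauli coefficients of a Hermitian operator. -/
def pauliCoeff (s : Q → Fin 4) (A : Op Q) : ℝ := pauliExp s A / 2 ^ Fintype.card Q

lemma sum_pauliCoeff_smul {A : Op Q} (hA : A.IsHermitian) :
    ∑ s : Q → Fin 4, (pauliCoeff s A : ℂ) • pauliString s = A := by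
  conv_rhs => rw [← sum_trace_smul_pauliString A]
  refine Finset.sum_congr rfl fun s _ => ?_
  rw [trace_pauliString_mul_of_isHermitian s hA, pauliCoeff]
  push_cast
  rfl

/-- Expansion of `Tr(A B)` with `A` Hermitian. -/
lemma re_trace_mul_eq_sum {A : Op Q} (hA : A.IsHermitian) (B : Op Q) :
    (A * B).trace.re = ∑ s : Q → Fin 4, pauliCoeff s A * pauliExp s B := by
  conv_lhs => rw [← sum_pauliCoeff_smul hA]
  simp [Finset.sum_mul, Matrix.trace_sum, pauliExp]

end PauliAlgebra

section Splitting

/-! ### Splitting a register -/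

variable {Q A B : Type} [Fintype Q] [Fintype A] [Fintype B]

/-- The computational basis of a register split into two parts. -/
def splitBasis (ε : A ⊕ B ≃ Q) : (Q → Fin 2) ≃ (A → Fin 2) × (B → Fin 2) :=
  (Equiv.arrowCongr ε.symm (Equiv.refl _)).trans (Equiv.sumArrowEquivProdArrow _ _ _)

/-- The tensor product of operators on the two parts of a split register. -/
def splitTensor (ε : A ⊕ B ≃ Q) (X : Op A) (Y : Op B) : Op Q :=
  (X ⊗ₖ Y).submatrix (splitBasis ε) (splitBasis ε)

lemma pauliString_eq_splitTensor (ε : A ⊕ B ≃ Q) (s : Q → Fin 4) :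
    pauliString s = splitTensor ε (pauliString fun a => s (ε (.inl a)))
      (pauliString fun b => s (ε (.inr b))) := by
  ext x y
  simp only [splitTensor, pauliString, Matrix.submatrix_apply, Matrix.kroneckerMap_apply,
    Matrix.of_apply]
  rw [← Equiv.prod_comp ε, Fintype.prod_sum_type]
  rfl

lemma splitTensor_conjTranspose (ε : A ⊕ B ≃ Q) (X : Op A) (Y : Op B) :
    (splitTensor ε X Y)ᴴ = splitTensor ε Xᴴ Yᴴ := by
  rw [splitTensor, Matrix.conjTranspose_submatrix, Matrix.conjTranspose_kronecker, splitTensor]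

variable [DecidableEq Q] [DecidableEq A] [DecidableEq B]

lemma splitTensor_mul (ε : A ⊕ B ≃ Q) (X X' : Op A) (Y Y' : Op B) :
    splitTensor ε X Y * splitTensor ε X' Y' = splitTensor ε (X * X') (Y * Y') := by
  rw [splitTensor, splitTensor, Matrix.submatrix_mul_equiv, ← Matrix.mul_kronecker_mul]
  rfl

lemma trace_splitTensor (ε : A ⊕ B ≃ Q) (X : Op A) (Y : Op B) :
    (splitTensor ε X Y).trace = X.trace * Y.trace := by
  rw [← Matrix.trace_kronecker]
  exact Equiv.sum_comp (splitBasis ε) fun i => (X ⊗ₖ Y) i i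

/-- `X ↦ X ⊗ 1` for a split register. -/
def splitHom (ε : A ⊕ B ≃ Q) : Op A →ₐ[ℂ] Op Q where
  toFun X := splitTensor ε X 1
  map_one' := by simp [splitTensor]
  map_mul' X Y := by rw [splitTensor_mul, mul_one]
  map_zero' := by simp [splitTensor]
  map_add' X Y := by rw [splitTensor, Matrix.add_kronecker, Matrix.submatrix_add]; rfl
  commutes' c := by
    rw [Algebra.algebraMap_eq_smul_one, Algebra.algebraMap_eq_smul_one, splitTensor,
      Matrix.smul_kronecker, Matrix.one_kronecker_one, Matrix.submatrix_smul]
    simp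

lemma splitHom_apply (ε : A ⊕ B ≃ Q) (X : Op A) : splitHom ε X = splitTensor ε X 1 := rfl

lemma continuous_splitHom (ε : A ⊕ B ≃ Q) : Continuous (splitHom ε) :=
  (splitHom ε).toLinearMap.continuous_of_finiteDimensional

-- An algebra homomorphism that is continuous, here by finite dimension, passes through the
-- exponential series.
open scoped Matrix.Norms.Operator in
lemma splitHom_exp (ε : A ⊕ B ≃ Q) (X : Op A) :
    splitHom ε (NormedSpace.exp X) = NormedSpace.exp (splitHom ε X) :=
  NormedSpace.map_exp (splitHom ε) (continuous_splitHom ε) X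

/-- An operator on the qubits in `S` has no Pauli component that is supported elsewhere. -/
lemma ActsOn.pauliCoeff_eq_zero {S : Finset Q} {H : Op Q} (hH : ActsOn S H) {s : Q → Fin 4}
    (hs : ∃ q, q ∉ S ∧ s q ≠ 0) : pauliCoeff s H = 0 := by
  obtain ⟨C, hC⟩ := hH
  set ε : {q // q ∈ S} ⊕ {q // q ∉ S} ≃ Q := Equiv.sumCompl (· ∈ S) with hε
  have h : H = splitTensor ε C 1 := by
    ext x y
    rw [hC, splitTensor, Matrix.submatrix_apply, Matrix.kroneckerMap_apply, Matrix.one_apply,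
      mul_ite, mul_one, mul_zero]
    refine if_congr ?_ rfl rfl
    simp only [funext_iff, Subtype.forall]
    rfl
  -- The trace factorizes, and the factor outside `S` is the trace of a nontrivial Pauli string,
  -- which vanishes.
  rw [pauliCoeff, pauliExp, h, pauliString_eq_splitTensor ε, splitTensor_mul, trace_splitTensor,
    mul_one, trace_pauliString, if_neg]
  · simp
  · obtain ⟨q, hq, hsq⟩ := hs
    exact fun h0 => hsq (by simpa [hε] using congrFun h0 ⟨q, hq⟩)

end Splitting

section Pairs

/-! ### Two-qubit gates in a register -/

variable {Q : Type} [Fintype Q] [DecidableEq Q]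

/-- The splitting of a register into the pair `e` and the remaining qubits. -/
def pairSplit (e : Q × Q) (he : e.1 ≠ e.2) :
    Fin 2 ⊕ ((Set.range ![e.1, e.2])ᶜ : Set Q) ≃ Q :=
  ((Equiv.ofInjective ![e.1, e.2] (by
    intro i j; fin_cases i <;> fin_cases j <;> simp [he, he.symm])).sumCongr (Equiv.refl _)).trans
    (Equiv.Set.sumCompl _)

lemma pairSplit_inl (e : Q × Q) (he : e.1 ≠ e.2) (i : Fin 2) :
    pairSplit e he (.inl i) = ![e.1, e.2] i := rfl

lemma pairSplit_inr (e : Q × Q) (he : e.1 ≠ e.2) (b) : pairSplit e he (.inr b) = b.1 := rfl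

/-- The string `P` with its values on the pair `e` replaced by `q`. -/
def setPair (e : Q × Q) (P : Q → Fin 4) (q : Fin 2 → Fin 4) : Q → Fin 4 :=
  Function.update (Function.update P e.1 (q 0)) e.2 (q 1)

/-- The values of the string `P` on the pair `e`. -/
def getPair (e : Q × Q) (P : Q → Fin 4) : Fin 2 → Fin 4 := ![P e.1, P e.2]

lemma setPair_fst {e : Q × Q} (he : e.1 ≠ e.2) (P : Q → Fin 4) (q : Fin 2 → Fin 4) :
    setPair e P q e.1 = q 0 := by
  simp [setPair, he]

lemma setPair_snd (e : Q × Q) (P : Q → Fin 4) (q : Fin 2 → Fin 4) : setPair e P q e.2 = q 1 := by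
  simp [setPair]

lemma setPair_of_ne {e : Q × Q} (P : Q → Fin 4) (q : Fin 2 → Fin 4) {a : Q} (h1 : a ≠ e.1)
    (h2 : a ≠ e.2) : setPair e P q a = P a := by
  simp [setPair, h1, h2]

lemma setPair_getPair (e : Q × Q) (P : Q → Fin 4) : setPair e P (getPair e P) = P := by
  simp [setPair, getPair]

lemma pauliString_setPair (e : Q × Q) (he : e.1 ≠ e.2) (P : Q → Fin 4) (q : Fin 2 → Fin 4) :
    pauliString (setPair e P q) = splitTensor (pairSplit e he) (pauliString q)
      (pauliString fun b => P b.1) := by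
  rw [pauliString_eq_splitTensor (pairSplit e he)]
  congr 2
  · funext i
    rw [pairSplit_inl]
    fin_cases i
    · exact setPair_fst he P q
    · exact setPair_snd e P q
  · funext b
    rw [pairSplit_inr]
    have := b.2
    simp only [Set.mem_compl_iff, Set.mem_range, Fin.exists_fin_two, not_or] at this
    exact setPair_of_ne P q (fun h => this.1 h.symm) fun h => this.2 h.symm

/-- The operator of the full register acting as `V` on the pair `e`. -/
def onPair (e : Q × Q) (V : Op (Fin 2)) : Op Q :=
  if he : e.1 ≠ e.2 then splitHom (pairSplit e he) V else 1

lemma continuous_onPair (e : Q × Q) : Continuous (onPair e) := by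
  unfold onPair
  split_ifs with he
  · exact continuous_splitHom _
  · exact continuous_const

/-- The Pauli transfer matrix of conjugation by `V`. -/
def transfer (V : Op (Fin 2)) (p q : Fin 2 → Fin 4) : ℝ :=
  pauliCoeff p (V * pauliString q * Vᴴ)

lemma pauliString_isHermitian (s : Q → Fin 4) : (pauliString s).IsHermitian :=
  pauliString_conjTranspose s

/-- Heisenberg picture: by cyclicity of the trace, the rows of the transfer matrix are the Pauli
coefficients of the back-evolved observables. -/
lemma sum_transfer_smul (V : Op (Fin 2)) (p : Fin 2 → Fin 4) :
    Vᴴ * pauliString p * V = ∑ q, (transfer V p q : ℂ) • pauliString q := by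
  rw [← sum_pauliCoeff_smul (isHermitian_conjTranspose_mul_mul V (pauliString_isHermitian p))]
  refine Finset.sum_congr rfl fun q _ => ?_
  rw [transfer, pauliCoeff, pauliCoeff, pauliExp, pauliExp,
    Matrix.trace_mul_comm (pauliString p), Matrix.mul_assoc (V * _),
    Matrix.mul_assoc V, Matrix.trace_mul_comm V, Matrix.mul_assoc (pauliString q)]

lemma splitTensor_sum_smul {A B ι : Type} [Fintype A] [Fintype B] (ε : A ⊕ B ≃ Q) (s : Finset ι)
    (c : ι → ℂ) (X : ι → Op A) (Y : Op B) :
    splitTensor ε (∑ i ∈ s, c i • X i) Y = ∑ i ∈ s, c i • splitTensor ε (X i) Y := by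
  ext x y
  simp [splitTensor, Matrix.sum_apply, Finset.sum_mul, mul_assoc]

lemma onPair_conj_pauliString {e : Q × Q} (he : e.1 ≠ e.2) (V : Op (Fin 2)) (P : Q → Fin 4) :
    (onPair e V)ᴴ * pauliString P * onPair e V =
      ∑ q, (transfer V (getPair e P) q : ℂ) • pauliString (setPair e P q) := by
  simp only [pauliString_setPair e he, ← splitTensor_sum_smul, ← sum_transfer_smul]
  rw [onPair, dif_pos he, splitHom_apply, splitTensor_conjTranspose, conjTranspose_one]
  conv_lhs => rw [← setPair_getPair e P, pauliString_setPair e he]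
  rw [splitTensor_mul, splitTensor_mul, one_mul, mul_one]

/-- The action of a two-qubit gate on Pauli expectations. -/
lemma pauliExp_onPair_conj {e : Q × Q} (he : e.1 ≠ e.2) (V : Op (Fin 2)) (P : Q → Fin 4)
    (M : Op Q) :
    pauliExp P (onPair e V * M * (onPair e V)ᴴ) =
      ∑ q, transfer V (getPair e P) q * pauliExp (setPair e P q) M := by
  have h : (pauliString P * (onPair e V * M * (onPair e V)ᴴ)).trace =
      ((onPair e V)ᴴ * pauliString P * onPair e V * M).trace := by
    rw [← Matrix.mul_assoc, Matrix.trace_mul_comm]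
    simp only [Matrix.mul_assoc]
  rw [pauliExp, h, onPair_conj_pauliString he]
  simp [Finset.sum_mul, Matrix.trace_sum, pauliExp]

/-- Conjugation by two-qubit gates on the pairs in a list. -/
def conjPairs (V : Q × Q → Op (Fin 2)) (M : Op Q) : List (Q × Q) → Op Q
  | [] => M
  | e :: l => onPair e (V e) * conjPairs V M l * (onPair e (V e))ᴴ

end Pairs

section Layers

/-! ### Layers as products of two-qubit gates -/

variable {N : ℕ}

lemma pairPauli_eq_splitHom {e : Qubit N × Qubit N} (he : e.1 ≠ e.2) (p : PauliPair) :
    pairPauli e p = splitHom (pairSplit e he) (pauliString ![p.1.1, p.1.2]) := by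
  have h := pauliString_setPair e he 0 ![p.1.1, p.1.2]
  simp only [Pi.zero_apply] at h
  rw [splitHom_apply, ← pauliString_zero]
  exact h

lemma exp_sum_pairPauli {e : Qubit N × Qubit N} (he : e.1 ≠ e.2) (θ : PauliPair → ℝ) :
    NormedSpace.exp ((-Complex.I) • ∑ p : PauliPair, (θ p : ℂ) • pairPauli e p) =
      onPair e (twoQubitGate θ) := by
  rw [onPair, dif_pos he, twoQubitGate, splitHom_exp]
  simp only [map_smul, map_sum, pairPauli_eq_splitHom he]

/-- Two pairs without a common qubit. -/
def DisjointPairs {Q : Type} (e e' : Q × Q) : Prop :=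
  e.1 ≠ e'.1 ∧ e.1 ≠ e'.2 ∧ e.2 ≠ e'.1 ∧ e.2 ≠ e'.2

/-- On every qubit at least one of the two strings is the identity, so all the commutation signs are
1. -/
lemma DisjointPairs.commute_pairPauli {e e' : Qubit N × Qubit N} (h : DisjointPairs e e')
    (p p' : PauliPair) : Commute (pairPauli e p) (pairPauli e' p') := by
  unfold Commute SemiconjBy pairPauli
  rw [pauliString_mul_comm, Finset.prod_eq_one]
  · simp
  · intro q _
    obtain ⟨h1, h2, h3, h4⟩ := h
    by_cases hq : q = e.1 ∨ q = e.2
    · have : q ≠ e'.1 ∧ q ≠ e'.2 := by rcases hq with rfl | rfl <;> exact ⟨‹_›, ‹_›⟩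
      simp [pauliSign, this.1, this.2]
    · push Not at hq
      simp [pauliSign, hq.1, hq.2]

/-- Generators on disjoint pairs commute, so the exponential of the sum is the product of the gates.
A list fixes an order for the product. -/
lemma exp_sum_pairs_conj (θ : LayerParams N) (M : Op (Qubit N)) (l : List (Qubit N × Qubit N))
    (hne : ∀ e ∈ l, e.1 ≠ e.2) (hl : l.Pairwise DisjointPairs) :
    NormedSpace.exp ((-Complex.I) • (l.map fun e => ∑ p : PauliPair, (θ e p : ℂ) • pairPauli e p).sum)
      * M * (NormedSpace.exp ((-Complex.I) •
        (l.map fun e => ∑ p : PauliPair, (θ e p : ℂ) • pairPauli e p).sum))ᴴ =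
      conjPairs (fun e => twoQubitGate (θ e)) M l := by
  induction l with
  | nil => simp [conjPairs]
  | cons e l ih =>
    rw [List.pairwise_cons] at hl
    rw [conjPairs, ← ih (fun e' he' => hne e' (List.mem_cons_of_mem _ he')) hl.2,
      ← exp_sum_pairPauli (hne e List.mem_cons_self), List.map_cons, List.sum_cons, smul_add,
      Matrix.exp_add_of_commute, Matrix.conjTranspose_mul]
    · simp only [Matrix.mul_assoc]
    · refine Commute.smul_left (Commute.smul_right ?_ _) _
      refine Commute.list_sum_right _ _ fun X hX => ?_
      obtain ⟨e', he', rfl⟩ := List.mem_map.mp hX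
      exact Commute.sum_left _ _ _ fun p _ => Commute.sum_right _ _ _ fun p' _ =>
        ((hl.1 e' he').commute_pairPauli p p').smul_left _ |>.smul_right _

lemma gates_fst_ne_snd {κ : LayerKind} {e : Qubit N × Qubit N} (he : e ∈ gates N κ) :
    e.1 ≠ e.2 := by
  cases κ <;> simp only [gates, mem_image, mem_filter, mem_univ, true_and, Prod.exists] at he
  · obtain ⟨j, rfl⟩ := he
    simp
  all_goals
    obtain ⟨a, b, ⟨-, hab⟩, rfl⟩ := he
    simp only [ne_eq, Sum.inl.injEq, Fin.ext_iff]
    lia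

lemma gates_disjoint {κ : LayerKind} {e e' : Qubit N × Qubit N} (he : e ∈ gates N κ)
    (he' : e' ∈ gates N κ) (hne : e ≠ e') : DisjointPairs e e' := by
  cases κ <;> simp only [gates, mem_image, mem_filter, mem_univ, true_and, Prod.exists] at he he'
  · obtain ⟨j, rfl⟩ := he
    obtain ⟨j', rfl⟩ := he'
    simpa [DisjointPairs] using hne
  all_goals
    obtain ⟨a, b, ⟨ha, hab⟩, rfl⟩ := he
    obtain ⟨a', b', ⟨ha', hab'⟩, rfl⟩ := he'
    simp only [DisjointPairs, ne_eq, Sum.inl.injEq, Fin.ext_iff, Prod.mk.injEq] at hne ⊢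
    grind

lemma iteration_eq_conjPairs (κ : LayerKind) (θ : LayerParams N) (ρ : Op (Fin N)) :
    iteration κ θ ρ = traceAncillas
      (conjPairs (fun e => twoQubitGate (θ e)) (attachAncillas ρ) (gates N κ).toList) := by
  rw [← exp_sum_pairs_conj]
  · rw [iteration, layerUnitary, Finset.sum_map_toList]
  · exact fun e he => gates_fst_ne_snd (Finset.mem_toList.mp he)
  · exact (Finset.nodup_toList _).imp_of_mem fun ha hb hab =>
      gates_disjoint (Finset.mem_toList.mp ha) (Finset.mem_toList.mp hb) hab

/-! ### Resetting and discarding ancillas -/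

/-- The partial trace is dual to padding an observable with the identity on the ancillas. -/
lemma pauliExp_traceAncillas (P : Fin N → Fin 4) (M : Op (Qubit N)) :
    pauliExp P (traceAncillas M) = pauliExp (Sum.elim P 0) M := by
  have h : pauliString (Sum.elim P 0 : Qubit N → Fin 4) =
      splitTensor (Equiv.refl _) (pauliString P) 1 := by
    rw [pauliString_eq_splitTensor (Equiv.refl _), ← pauliString_zero]
    rfl
  have hsum : ∀ f : (Qubit N → Fin 2) → ℂ, ∑ x, f x = ∑ x, ∑ a, f (Sum.elim x a) := fun f => by
    rw [← Equiv.sum_comp (Equiv.sumArrowEquivProdArrow _ _ _).symm, Fintype.sum_prod_type]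
    rfl
  have hentry : ∀ (x y a b : Fin N → Fin 2),
      splitTensor (Equiv.refl (Qubit N)) (pauliString P) 1 (Sum.elim x a) (Sum.elim y b) =
        pauliString P x y * (1 : Op (Fin N)) a b := fun _ _ _ _ => rfl
  rw [pauliExp, pauliExp, h]
  congr 1
  simp only [Matrix.trace, Matrix.diag_apply, Matrix.mul_apply, hsum, hentry, traceAncillas,
    Matrix.of_apply, Matrix.one_apply, Finset.mul_sum]
  refine Finset.sum_congr rfl fun x _ => ?_
  rw [Finset.sum_comm]
  exact Finset.sum_congr rfl fun a _ => Finset.sum_congr rfl fun y _ => by simp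

/-- The diagonal entry ⟨0|·|0⟩ is 1 for I and Z and 0 for X and Y. -/
lemma pauliExp_attachAncillas (P : Qubit N → Fin 4) (ρ : Op (Fin N)) :
    pauliExp P (attachAncillas ρ) =
      pauliExp (fun j => P (.inl j)) ρ * ∏ j, if P (.inr j) = 0 ∨ P (.inr j) = 3 then 1 else 0 := by
  have h : attachAncillas ρ = splitTensor (Equiv.refl _) ρ (Matrix.single 0 0 1) := by
    ext x y
    rw [splitTensor, Matrix.submatrix_apply, Matrix.kroneckerMap_apply, attachAncillas,
      Matrix.of_apply, Matrix.single_apply, mul_ite, mul_one, mul_zero]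
    refine if_congr ?_ rfl rfl
    simp only [funext_iff, eq_comm (a := (0 : Fin 2)), Pi.zero_apply]
    rfl
  have hz : ∀ i : Fin 4, pauli i 0 0 = ((if i = 0 ∨ i = 3 then 1 else 0 : ℝ) : ℂ) := by
    intro i; fin_cases i <;> simp [pauli]
  rw [pauliExp, h, pauliString_eq_splitTensor (Equiv.refl _), splitTensor_mul, trace_splitTensor,
    Matrix.trace_mul_single, MulOpposite.op_one, one_smul]
  simp only [pauliString, Matrix.of_apply, Pi.zero_apply, hz]
  rw [← Complex.ofReal_prod, Complex.re_mul_ofReal]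
  rfl

end Layers

open MeasureTheory

section Twirl

/-! ### Second moments of Haar random two-qubit gates -/

lemma transfer_mul_of_conj {W : Op (Fin 2)} {p p' : Fin 2 → Fin 4} {c : ℝ}
    (h : Wᴴ * pauliString p * W = (c : ℂ) • pauliString p') (V : Op (Fin 2)) (q : Fin 2 → Fin 4) :
    transfer (W * V) p q = c * transfer V p' q := by
  have h1 : (pauliString p * (W * V * pauliString q * (W * V)ᴴ)).trace =
      (Wᴴ * pauliString p * W * (V * pauliString q * Vᴴ)).trace := by
    rw [Matrix.conjTranspose_mul, ← Matrix.mul_assoc, ← Matrix.mul_assoc, Matrix.trace_mul_comm]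
    simp only [Matrix.mul_assoc]
  rw [transfer, pauliCoeff, pauliExp, h1, h, Matrix.smul_mul, Matrix.trace_smul, smul_eq_mul,
    Complex.re_ofReal_mul, transfer, pauliCoeff, pauliExp, mul_div_assoc]

/-- Every unitary acts by conjugation as an element of `SU(4)`. -/
lemma exists_SU4_conj {U : Op (Fin 2)} (hU : Uᴴ * U = 1) :
    ∃ g : SU4, ∀ A : Op (Fin 2), (g : Op (Fin 2))ᴴ * A * g = Uᴴ * A * U := by
  -- The scalar c is the phase that corrects the determinant: on a space of dimension 4, det(cU) =
  -- c⁴ det U. It has modulus 1 and so cancels in the conjugation.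
  obtain ⟨c, hc⟩ := IsAlgClosed.exists_pow_nat_eq (U.det)⁻¹ (n := 4) (by norm_num)
  have hdet : star U.det * U.det = 1 := by
    rw [← Matrix.det_conjTranspose, ← Matrix.det_mul, hU, Matrix.det_one]
  have hdet0 : U.det ≠ 0 := right_ne_zero_of_mul_eq_one hdet
  have hnorm : ‖U.det‖ = 1 := by
    have h1 : ‖U.det‖ * ‖U.det‖ = 1 := by
      have := congrArg norm hdet
      rwa [norm_mul, norm_star, norm_one] at this
    nlinarith [norm_nonneg U.det]
  have hcn : ‖c‖ = 1 := by
    have h1 : ‖c‖ ^ 4 = 1 := by rw [← norm_pow, hc, norm_inv, hnorm, inv_one]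
    exact (pow_eq_one_iff_of_nonneg (norm_nonneg c) (by norm_num)).mp h1
  have hcc : star c * c = 1 := by
    have : star c * c = ((‖c‖ ^ 2 : ℝ) : ℂ) := by
      rw [Complex.star_def, mul_comm, Complex.mul_conj, Complex.normSq_eq_norm_sq]
    rw [this, hcn]; simp
  have hconj : ∀ A : Op (Fin 2), (c • U)ᴴ * A * (c • U) = Uᴴ * A * U := by
    intro A
    rw [Matrix.conjTranspose_smul, Matrix.smul_mul, Matrix.smul_mul, Matrix.mul_smul, smul_smul,
      hcc, one_smul]
  refine ⟨⟨c • U, ?_⟩, hconj⟩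
  rw [Matrix.mem_specialUnitaryGroup_iff, Matrix.mem_unitaryGroup_iff']
  refine ⟨?_, ?_⟩
  · have := hconj 1
    rw [Matrix.mul_one, Matrix.mul_one, hU] at this
    exact this
  · rw [Matrix.det_smul]
    have : Fintype.card (Fin 2 → Fin 2) = 4 := by simp
    rw [this, hc, inv_mul_cancel₀ hdet0]

/-- The sign by which two Pauli operators commute. -/
def pairSign (p q : Fin 2 → Fin 4) : ℤ := ∏ i, pauliSign (p i) (q i)

/-- Distinct Pauli strings have distinct commutation characters: a single-qubit Pauli at a position
where they differ separates them. -/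
lemma exists_pairSign_ne {p p' : Fin 2 → Fin 4} (h : p ≠ p') :
    ∃ r, pairSign r p * pairSign r p' = -1 := by
  have key : ∀ i j : Fin 4, i ≠ j → ∃ s, pauliSign s i * pauliSign s j = -1 := by decide
  obtain ⟨k, hk⟩ := Function.ne_iff.mp h
  obtain ⟨s, hs⟩ := key _ _ hk
  refine ⟨Pi.single k s, ?_⟩
  rw [pairSign, pairSign, ← Finset.prod_mul_distrib, Finset.prod_eq_single k]
  · simpa using hs
  · intro b _ hb
    simp [Pi.single_eq_of_ne hb, pauliSign]
  · simp

/-- Two nontrivial strings may commute with each other, but some third one anticommutes with both.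
It is the middle link in `twirlMoment_diag`. -/
lemma exists_anticommuting {p p' : Fin 2 → Fin 4} (hp : p ≠ 0) (hp' : p' ≠ 0) :
    ∃ r, r ≠ 0 ∧ pairSign p r = -1 ∧ pairSign r p' = -1 := by
  have key : ∀ a b a' b' : Fin 4, (a ≠ 0 ∨ b ≠ 0) → (a' ≠ 0 ∨ b' ≠ 0) →
      ∃ c d : Fin 4, (c ≠ 0 ∨ d ≠ 0) ∧ pauliSign a c * pauliSign b d = -1 ∧
        pauliSign c a' * pauliSign d b' = -1 := by decide
  have hne : ∀ r : Fin 2 → Fin 4, r ≠ 0 ↔ r 0 ≠ 0 ∨ r 1 ≠ 0 := fun r => by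
    rw [Function.ne_iff, Fin.exists_fin_two]; rfl
  obtain ⟨c, d, h1, h2, h3⟩ := key (p 0) (p 1) (p' 0) (p' 1) ((hne p).mp hp) ((hne p').mp hp')
  refine ⟨![c, d], (hne _).mpr h1, ?_, ?_⟩ <;> rwa [pairSign, Fin.prod_univ_two]

/-- The witness is the Pauli string `r` itself, up to a phase. -/
lemma exists_SU4_sign (r : Fin 2 → Fin 4) : ∃ g : SU4, ∀ (V : Op (Fin 2)) (p q : Fin 2 → Fin 4),
    transfer (g * V) p q = pairSign r p * transfer V p q := by
  obtain ⟨g, hg⟩ := exists_SU4_conj (U := pauliString r)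
    (by rw [pauliString_conjTranspose, pauliString_mul_self])
  refine ⟨g, fun V p q => ?_⟩
  refine transfer_mul_of_conj ?_ V q
  rw [hg, pauliString_conjTranspose, pauliString_mul_comm, Matrix.smul_mul, Matrix.mul_assoc,
    pauliString_mul_self, Matrix.mul_one, pairSign]
  simp

/-- For anticommuting Pauli strings A and B, (A + B)/√2 is a Hermitian unitary, and conjugation by
it exchanges A and B. -/
lemma exists_SU4_rotate {p p' : Fin 2 → Fin 4} (h : pairSign p p' = -1) :
    ∃ g : SU4, ∀ (V : Op (Fin 2)) (q : Fin 2 → Fin 4),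
      transfer (g * V) p q = transfer V p' q := by
  set A := pauliString p with hA
  set B := pauliString p' with hB
  have hAA : A * A = 1 := pauliString_mul_self p
  have hBB : B * B = 1 := pauliString_mul_self p'
  have hAB : A * B = -(B * A) := by
    rw [hA, hB, pauliString_mul_comm]
    change ((pairSign p p' : ℤ) : ℂ) • _ = _
    rw [h]; simp
  set c : ℂ := (((Real.sqrt 2)⁻¹ : ℝ) : ℂ) with hc
  have hcc : c * c = 1 / 2 := by
    rw [hc, ← Complex.ofReal_mul, ← mul_inv, Real.mul_self_sqrt (by norm_num)]
    norm_num
  have hU : (c • (A + B))ᴴ = c • (A + B) := by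
    rw [Matrix.conjTranspose_smul, Matrix.conjTranspose_add, hA, hB, pauliString_conjTranspose,
      pauliString_conjTranspose, hc, Complex.star_def, Complex.conj_ofReal]
  obtain ⟨g, hg⟩ := exists_SU4_conj (U := c • (A + B)) (by
    rw [hU, smul_mul_smul_comm, hcc, add_mul, mul_add, mul_add, hAA, hBB, hAB]
    module)
  refine ⟨g, fun V q => ?_⟩
  rw [← one_mul (transfer V p' q)]
  refine transfer_mul_of_conj ?_ V q
  have hconj : (A + B) * A * (A + B) = (2 : ℂ) • B := by
    have h1 : (A + B) * A * (A + B) = A * A * A + A * A * B + B * (A * A) + B * (A * B) := by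
      noncomm_ring
    have h2 : B * (A * B) = - A := by
      rw [hAB, mul_neg, ← mul_assoc, hBB, one_mul]
    rw [h1, h2, hAA, one_mul, one_mul, mul_one]
    module
  rw [hg, hU, Matrix.smul_mul, Matrix.smul_mul, Matrix.mul_smul, smul_smul, ← hA, hconj, hcc,
    smul_smul]
  simp [hB]

lemma transfer_zero_left {V : Op (Fin 2)} (hV : Vᴴ * V = 1) (q : Fin 2 → Fin 4) :
    transfer V 0 q = if q = 0 then 1 else 0 := by
  rw [transfer, pauliCoeff, pauliExp, pauliString_zero, one_mul, Matrix.trace_mul_comm,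
    ← Matrix.mul_assoc, hV, one_mul, trace_pauliString]
  split_ifs <;> norm_num

/-- Unitary conjugation preserves the Hilbert–Schmidt inner product, for which the Pauli strings are
orthogonal. -/
lemma transfer_orthogonal {V : Op (Fin 2)} (hV : Vᴴ * V = 1) (q q' : Fin 2 → Fin 4) :
    ∑ p, transfer V p q * transfer V p q' = if q = q' then 1 else 0 := by
  have h := re_trace_mul_eq_sum (isHermitian_mul_mul_conjTranspose V (pauliString_isHermitian q))
    (V * pauliString q' * Vᴴ)
  have h1 : (V * pauliString q * Vᴴ * (V * pauliString q' * Vᴴ)).trace =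
      (pauliString q * pauliString q').trace := by
    rw [Matrix.trace_mul_comm]
    calc _ = (V * (pauliString q' * (Vᴴ * V) * pauliString q * Vᴴ)).trace := by
          simp only [Matrix.mul_assoc]
      _ = _ := by
        rw [hV, mul_one, Matrix.trace_mul_comm, Matrix.mul_assoc, hV, mul_one,
          Matrix.trace_mul_comm]
  rw [h1, trace_pauliString_mul_pauliString] at h
  have h2 : ∀ p, transfer V p q * transfer V p q' =
      pauliCoeff p (V * pauliString q * Vᴴ) * pauliExp p (V * pauliString q' * Vᴴ) / 4 := by
    intro p
    rw [transfer, transfer, pauliCoeff, pauliCoeff, Fintype.card_fin]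
    ring
  simp only [h2, ← Finset.sum_div, ← h]
  split_ifs <;> norm_num

lemma SU4.conjTranspose_mul_self (g : SU4) : (g : Op (Fin 2))ᴴ * (g : Op (Fin 2)) = 1 :=
  Matrix.mem_unitaryGroup_iff'.mp (Matrix.specialUnitaryGroup_le_unitaryGroup g.2)

lemma continuous_pauliExp {Q : Type} [Fintype Q] [DecidableEq Q] (s : Q → Fin 4) :
    Continuous (pauliExp s) := by
  unfold pauliExp
  fun_prop

lemma continuous_transfer (p q : Fin 2 → Fin 4) : Continuous fun V => transfer V p q := by
  have h : Continuous fun V : Op (Fin 2) => V * pauliString q * Vᴴ := by fun_prop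
  exact ((continuous_pauliExp p).comp h).div_const _

variable {ι : Type} [DecidableEq ι] {μ : Measure (ι → SU4)} [Countable ι]

/-- A function on families of gates that does not depend on the gate `i`. -/
def IgnoresGate {α : Type} (i : ι) (X : (ι → SU4) → α) : Prop :=
  ∀ g v, X (Pi.mulSingle i g * v) = X v

/-- The mixed moment of two entries of the transfer matrix of a gate with an independent weight. -/
def twirlMoment (μ : Measure (ι → SU4)) (i : ι) (X : (ι → SU4) → ℝ) (p q p' q' : Fin 2 → Fin 4) :
    ℝ := ∫ v, transfer (v i) p q * transfer (v i) p' q' * X v ∂μ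

/-- Second countability makes the product σ-algebra on families of gates the Borel one, so
continuous functions of the gates are measurable. -/
instance : SecondCountableTopology (Op (Fin 2)) :=
  inferInstanceAs (SecondCountableTopology ((Fin 2 → Fin 2) → (Fin 2 → Fin 2) → ℂ))

instance : SecondCountableTopology SU4 := TopologicalSpace.Subtype.secondCountableTopology _

/-- Multiplying only coordinate `i` by `g` preserves `μ` and leaves the weight `X` unchanged. -/
lemma twirlMoment_translate [μ.IsMulLeftInvariant] {i : ι} {X : (ι → SU4) → ℝ}
    (hX : IgnoresGate i X) (g : SU4) (p q p' q' : Fin 2 → Fin 4) :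
    ∫ v, transfer (g * v i) p q * transfer (g * v i) p' q' * X v ∂μ =
      twirlMoment μ i X p q p' q' := by
  rw [twirlMoment, ← integral_mul_left_eq_self (fun v : ι → SU4 =>
    transfer (v i) p q * transfer (v i) p' q' * X v) (Pi.mulSingle i g)]
  simp only [hX g, Pi.mul_apply, Pi.mulSingle_eq_same, Submonoid.coe_mul]

/-- Translation by a Pauli string that separates `p` from `p'` turns the moment into its negative.
-/
lemma twirlMoment_of_ne [μ.IsMulLeftInvariant] {i : ι} {X : (ι → SU4) → ℝ}
    (hX : IgnoresGate i X) {p p' : Fin 2 → Fin 4} (hp : p ≠ p') (q q' : Fin 2 → Fin 4) :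
    twirlMoment μ i X p q p' q' = 0 := by
  obtain ⟨r, hr⟩ := exists_pairSign_ne hp
  obtain ⟨g, hg⟩ := exists_SU4_sign r
  have h := twirlMoment_translate (μ := μ) hX g p q p' q'
  have h1 : ∀ v : ι → SU4, transfer (g * v i) p q * transfer (g * v i) p' q' * X v =
      -(transfer (v i) p q * transfer (v i) p' q' * X v) := by
    intro v
    have hr' : (pairSign r p : ℝ) * pairSign r p' = -1 := by exact_mod_cast hr
    rw [hg, hg]
    linear_combination transfer (v i) p q * transfer (v i) p' q' * X v * hr'
  simp only [h1, integral_neg] at h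
  change -twirlMoment μ i X p q p' q' = _ at h
  linarith

lemma twirlMoment_diag [μ.IsMulLeftInvariant] {i : ι} {X : (ι → SU4) → ℝ}
    (hX : IgnoresGate i X) {p p' : Fin 2 → Fin 4} (hp : p ≠ 0) (hp' : p' ≠ 0)
    (q q' : Fin 2 → Fin 4) :
    twirlMoment μ i X p q p q' = twirlMoment μ i X p' q p' q' := by
  have key : ∀ {a b : Fin 2 → Fin 4}, pairSign a b = -1 →
      twirlMoment μ i X a q a q' = twirlMoment μ i X b q b q' := by
    intro a b hab
    obtain ⟨g, hg⟩ := exists_SU4_rotate hab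
    rw [← twirlMoment_translate (μ := μ) hX g]
    simp only [hg]
    rfl
  obtain ⟨r, -, h1, h2⟩ := exists_anticommuting hp hp'
  exact (key h1).trans (key h2)

lemma twirlMoment_zero {i : ι} (X : (ι → SU4) → ℝ) (q q' : Fin 2 → Fin 4) :
    twirlMoment μ i X 0 q 0 q' = if q = 0 ∧ q' = 0 then ∫ v, X v ∂μ else 0 := by
  simp only [twirlMoment, transfer_zero_left (SU4.conjTranspose_mul_self _)]
  by_cases h : q = 0 <;> by_cases h' : q' = 0 <;> simp [h, h']

lemma integrable_of_continuous [IsFiniteMeasure μ] {X : (ι → SU4) → ℝ} (hX : Continuous X) :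
    Integrable X μ :=
  hX.integrable_of_hasCompactSupport (HasCompactSupport.of_compactSpace X)

/-- Orthogonality of the columns gives the sum over all rows. The zero row is known and the 15
others contribute equally, which determines each of them. Left invariance alone suffices, including
for the vanishing at q ≠ q'. -/
lemma twirlMoment_of_ne_zero [IsFiniteMeasure μ] [μ.IsMulLeftInvariant] {i : ι}
    {X : (ι → SU4) → ℝ} (hX : IgnoresGate i X) (hc : Continuous X) {p : Fin 2 → Fin 4}
    (hp : p ≠ 0) (q q' : Fin 2 → Fin 4) :
    twirlMoment μ i X p q p q' = if q = q' ∧ q ≠ 0 then (∫ v, X v ∂μ) / 15 else 0 := by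
  have hsum : ∑ r, twirlMoment μ i X r q r q' = if q = q' then ∫ v, X v ∂μ else 0 := by
    unfold twirlMoment
    rw [← integral_finsetSum]
    · simp only [← Finset.sum_mul, transfer_orthogonal (SU4.conjTranspose_mul_self _)]
      split_ifs <;> simp
    · intro r _
      refine integrable_of_continuous ?_
      have hv : Continuous fun v : ι → SU4 => (v i : Op (Fin 2)) :=
        continuous_subtype_val.comp (continuous_apply i)
      exact (((continuous_transfer r q).comp hv).mul ((continuous_transfer r q').comp hv)).mul hc
  rw [← Finset.add_sum_erase _ _ (Finset.mem_univ (0 : Fin 2 → Fin 4)), twirlMoment_zero,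
    Finset.sum_congr rfl fun r hr => twirlMoment_diag hX (Finset.ne_of_mem_erase hr) hp q q',
    Finset.sum_const, Finset.card_erase_of_mem (Finset.mem_univ _), Finset.card_univ,
    Fintype.card_fun, Fintype.card_fin, Fintype.card_fin] at hsum
  norm_num at hsum
  by_cases h1 : q = q'
  · subst h1
    by_cases h2 : q = 0
    · simp only [h2, and_self, if_true] at hsum
      simp only [h2, ne_eq, not_true_eq_false, and_false, if_false]
      linarith
    · simp only [h2, and_self, if_true, if_false] at hsum
      simp only [h2, ne_eq, not_false_eq_true, and_self, if_true]
      linarith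
  · have : ¬ (q = 0 ∧ q' = 0) := fun h => h1 (h.1.trans h.2.symm)
    simp only [h1, this, if_false] at hsum
    simp only [h1, false_and, if_false]
    linarith

end Twirl

section Moments

/-! ### Second moments of Pauli expectations -/

variable {ι : Type} [DecidableEq ι] [Countable ι] {μ : Measure (ι → SU4)}
variable {Q : Type} [Fintype Q] [DecidableEq Q]

/-- The second moments of the Pauli expectations of a random operator. -/
def moment (μ : Measure (ι → SU4)) (S : (ι → SU4) → Op Q) (P P' : Q → Fin 4) : ℝ :=
  ∫ v, pauliExp P (S v) * pauliExp P' (S v) ∂μ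

lemma moment_self_nonneg (S : (ι → SU4) → Op Q) (P : Q → Fin 4) : 0 ≤ moment μ S P P :=
  integral_nonneg fun _ => mul_self_nonneg _

lemma moment_onPair [IsFiniteMeasure μ] [μ.IsMulLeftInvariant] {i : ι} {S : (ι → SU4) → Op Q}
    (hS : IgnoresGate i S) (hc : Continuous S) {e : Q × Q} (he : e.1 ≠ e.2) (P P' : Q → Fin 4) :
    moment μ (fun v => onPair e (v i) * S v * (onPair e (v i))ᴴ) P P' =
      if getPair e P = getPair e P' then
        if getPair e P = 0 then moment μ S P P'
        else (∑ q with q ≠ 0, moment μ S (setPair e P q) (setPair e P' q)) / 15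
      else 0 := by
  set X : (Fin 2 → Fin 4) → (Fin 2 → Fin 4) → (ι → SU4) → ℝ := fun q q' v =>
    pauliExp (setPair e P q) (S v) * pauliExp (setPair e P' q') (S v) with hX
  have hXi : ∀ q q', IgnoresGate i (X q q') := fun q q' g v => by
    simp only [hX, hS g v]
  have hXc : ∀ q q', Continuous (X q q') := fun q q' =>
    ((continuous_pauliExp _).comp hc).mul ((continuous_pauliExp _).comp hc)
  have hv : Continuous fun v : ι → SU4 => (v i : Op (Fin 2)) :=
    continuous_subtype_val.comp (continuous_apply i)
  have hmain : moment μ (fun v => onPair e (v i) * S v * (onPair e (v i))ᴴ) P P' =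
      ∑ q, ∑ q', twirlMoment μ i (X q q') (getPair e P) q (getPair e P') q' := by
    have hint : ∀ q q', Integrable (fun v => transfer (v i) (getPair e P) q *
        transfer (v i) (getPair e P') q' * X q q' v) μ := fun q q' =>
      integrable_of_continuous <| (((continuous_transfer _ _).comp hv).mul
        ((continuous_transfer _ _).comp hv)).mul (hXc q q')
    calc _ = ∫ v, ∑ q, ∑ q', transfer (v i) (getPair e P) q * transfer (v i) (getPair e P') q' *
          X q q' v ∂μ := by
          refine integral_congr_ae (Filter.Eventually.of_forall fun v => ?_)
          simp only [pauliExp_onPair_conj he, Finset.sum_mul_sum]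
          exact Finset.sum_congr rfl fun q _ => Finset.sum_congr rfl fun q' _ => by
            simp only [hX]; ring
      _ = _ := by
          rw [integral_finsetSum _ fun q _ => integrable_finsetSum _ fun q' _ => hint q q']
          exact Finset.sum_congr rfl fun q _ => integral_finsetSum _ fun q' _ => hint q q'
  have hXX : ∀ q q', ∫ v, X q q' v ∂μ = moment μ S (setPair e P q) (setPair e P' q') :=
    fun _ _ => rfl
  rw [hmain]
  split_ifs with h1 h2
  · rw [← h1, h2]
    simp only [twirlMoment_zero, hXX, ite_and]
    have hP : setPair e P 0 = P := by
      conv_rhs => rw [← setPair_getPair e P, h2]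
    have hP' : setPair e P' 0 = P' := by
      conv_rhs => rw [← setPair_getPair e P', ← h1, h2]
    simp [hP, hP']
  · rw [← h1]
    simp only [twirlMoment_of_ne_zero (hXi _ _) (hXc _ _) h2, hXX, ite_and]
    simp [Finset.sum_div, Finset.sum_filter, ite_div]
  · exact Finset.sum_eq_zero fun q _ => Finset.sum_eq_zero fun q' _ =>
      twirlMoment_of_ne (hXi q q') h1 q q'

/-- Pauli expectations of strings that differ on `D` are uncorrelated. -/
def UncorrelatedOn (μ : Measure (ι → SU4)) (D : Set Q) (S : (ι → SU4) → Op Q) : Prop :=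
  ∀ P P' : Q → Fin 4, (∃ q ∈ D, P q ≠ P' q) → moment μ S P P' = 0

lemma UncorrelatedOn.onPair [IsFiniteMeasure μ] [μ.IsMulLeftInvariant] {i : ι}
    {S : (ι → SU4) → Op Q} {D : Set Q} (hD : UncorrelatedOn μ D S)
    (hS : IgnoresGate i S) (hc : Continuous S) {e : Q × Q} (he : e.1 ≠ e.2) :
    UncorrelatedOn μ (D ∪ {e.1, e.2}) fun v => onPair e (v i) * S v * (onPair e (v i))ᴴ := by
  rintro P P' ⟨a, ha, hne⟩
  rw [moment_onPair hS hc he]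
  split_ifs with h1 h2
  all_goals
    try rfl
  all_goals
    have hfst : P e.1 = P' e.1 := congrFun h1 0
    have hsnd : P e.2 = P' e.2 := congrFun h1 1
    have h1' : a ≠ e.1 := by rintro rfl; exact hne hfst
    have h2' : a ≠ e.2 := by rintro rfl; exact hne hsnd
    have haD : a ∈ D := by
      rcases ha with h | h | h
      · exact h
      · exact absurd h h1'
      · exact absurd h h2'
  · exact hD P P' ⟨a, haD, hne⟩
  -- Replacing the values on the pair does not affect the position `a`, so every averaged term still
  -- compares strings that differ on `D`.
  · rw [Finset.sum_eq_zero, zero_div]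
    intro q _
    refine hD _ _ ⟨a, haD, ?_⟩
    rwa [setPair_of_ne _ _ h1' h2', setPair_of_ne _ _ h1' h2']

lemma prod_eq_mul_mul_prod_pair {e : Q × Q} (he : e.1 ≠ e.2) (f : Q → ℝ) :
    ∏ q, f q = f e.1 * f e.2 * ∏ q ∈ (univ.erase e.1).erase e.2, f q := by
  rw [← Finset.mul_prod_erase univ f (mem_univ e.1),
    ← Finset.mul_prod_erase (univ.erase e.1) f (a := e.2) (by simp [he.symm]), mul_assoc]

/-- The weights on a pair of qubits after a Haar random gate. -/
def PairBound (w w' : Q → Fin 4 → ℝ) (e : Q × Q) : Prop :=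
  w' e.1 0 * w' e.2 0 ≤ w e.1 0 * w e.2 0 ∧
    ∀ p : Fin 2 → Fin 4, p ≠ 0 →
      w' e.1 (p 0) * w' e.2 (p 1) ≤ (∑ q : Fin 2 → Fin 4 with q ≠ 0, w e.1 (q 0) * w e.2 (q 1)) / 15

lemma prod_le_moment_onPair [IsFiniteMeasure μ] [μ.IsMulLeftInvariant] {i : ι}
    {S : (ι → SU4) → Op Q} (hS : IgnoresGate i S) (hc : Continuous S) {e : Q × Q}
    (he : e.1 ≠ e.2) {w w' : Q → Fin 4 → ℝ} (hw : ∀ q p, 0 ≤ w q p)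
    (hww' : ∀ q, q ≠ e.1 → q ≠ e.2 → w' q = w q) (hpair : PairBound w w' e)
    (hle : ∀ P : Q → Fin 4, ∏ q, w q (P q) ≤ moment μ S P P) (P : Q → Fin 4) :
    ∏ q, w' q (P q) ≤ moment μ (fun v => onPair e (v i) * S v * (onPair e (v i))ᴴ) P P := by
  set R := ∏ q ∈ (univ.erase e.1).erase e.2, w q (P q) with hR
  have hR0 : 0 ≤ R := Finset.prod_nonneg fun q _ => hw q _
  have hw'P : ∏ q, w' q (P q) = w' e.1 (P e.1) * w' e.2 (P e.2) * R := by
    rw [prod_eq_mul_mul_prod_pair he]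
    congr 1
    refine Finset.prod_congr rfl fun q hq => ?_
    rw [Finset.mem_erase, Finset.mem_erase] at hq
    rw [hww' q hq.2.1 hq.1]
  have hset : ∀ q, ∏ a, w a (setPair e P q a) = w e.1 (q 0) * w e.2 (q 1) * R := by
    intro q
    rw [prod_eq_mul_mul_prod_pair he, setPair_fst he, setPair_snd]
    congr 1
    refine Finset.prod_congr rfl fun a ha => ?_
    rw [Finset.mem_erase, Finset.mem_erase] at ha
    rw [setPair_of_ne _ _ ha.2.1 ha.1]
  rw [moment_onPair hS hc he, if_pos rfl, hw'P]
  split_ifs with h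
  · refine le_trans ?_ (hle P)
    have h0 : P e.1 = 0 := congrFun h 0
    have h1 : P e.2 = 0 := congrFun h 1
    rw [prod_eq_mul_mul_prod_pair he, h0, h1]
    exact mul_le_mul_of_nonneg_right hpair.1 hR0
  · calc _ ≤ (∑ q : Fin 2 → Fin 4 with q ≠ 0, w e.1 (q 0) * w e.2 (q 1)) / 15 * R :=
          mul_le_mul_of_nonneg_right (hpair.2 _ h) hR0
      _ = (∑ q : Fin 2 → Fin 4 with q ≠ 0, ∏ a, w a (setPair e P q a)) / 15 := by
          simp only [hset, ← Finset.sum_mul]; ring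
      _ ≤ _ := by
          gcongr
          exact hle _

/-- The qubits that belong to the pairs in a list. -/
def pairSupport (l : List (Q × Q)) : Set Q := {q | ∃ e ∈ l, q = e.1 ∨ q = e.2}

/-- On the pairs in `l`, the random gates `V` are distinct coordinates of which `M` is independent. -/
def IndependentGates (V : (ι → SU4) → Q × Q → Op (Fin 2)) (M : (ι → SU4) → Op Q)
    (l : List (Q × Q)) : Prop :=
  ∀ e ∈ l, ∃ i, (∀ v, V v e = v i) ∧ IgnoresGate i M ∧
    ∀ e' ∈ l, e' ≠ e → IgnoresGate i fun v => V v e'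

lemma IndependentGates.of_cons {V : (ι → SU4) → Q × Q → Op (Fin 2)} {M : (ι → SU4) → Op Q}
    {e : Q × Q} {l : List (Q × Q)} (h : IndependentGates V M (e :: l)) :
    IndependentGates V M l := fun e' he' => by
  obtain ⟨i, h1, h2, h3⟩ := h e' (List.mem_cons_of_mem _ he')
  exact ⟨i, h1, h2, fun e'' he'' => h3 e'' (List.mem_cons_of_mem _ he'')⟩

lemma IgnoresGate.conjPairs {V : (ι → SU4) → Q × Q → Op (Fin 2)} {M : (ι → SU4) → Op Q} {i : ι}
    (hM : IgnoresGate i M) {l : List (Q × Q)} (hV : ∀ e ∈ l, IgnoresGate i fun v => V v e) :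
    IgnoresGate i fun v => conjPairs (V v) (M v) l := by
  intro g v
  induction l with
  | nil => exact hM g v
  | cons e l ih =>
    have h1 := hV e List.mem_cons_self g v
    have h2 := ih fun e' he' => hV e' (List.mem_cons_of_mem _ he')
    simp only [SSGD.conjPairs] at h1 h2 ⊢
    rw [h1, h2]

lemma continuous_conjPairs {α : Type} [TopologicalSpace α] {V : α → Q × Q → Op (Fin 2)}
    {M : α → Op Q} (hM : Continuous M) (l : List (Q × Q))
    (hV : ∀ e ∈ l, Continuous fun v => V v e) : Continuous fun v => conjPairs (V v) (M v) l := by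
  induction l with
  | nil => exact hM
  | cons e l ih =>
    have h1 := (continuous_onPair e).comp (hV e List.mem_cons_self)
    exact (h1.mul (ih fun e' he' => hV e' (List.mem_cons_of_mem _ he'))).mul
      h1.matrix_conjTranspose

open scoped Classical in
/-- The effect of a layer of Haar random two-qubit gates on second moments. -/
lemma moment_conjPairs [IsFiniteMeasure μ] [μ.IsMulLeftInvariant]
    {V : (ι → SU4) → Q × Q → Op (Fin 2)} {M : (ι → SU4) → Op Q} (hM : Continuous M)
    {D : Set Q} (hD : UncorrelatedOn μ D M)
    {w w' : Q → Fin 4 → ℝ} (hw : ∀ q p, 0 ≤ w q p) (hw' : ∀ q p, 0 ≤ w' q p)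
    (hle : ∀ P : Q → Fin 4, ∏ q, w q (P q) ≤ moment μ M P P)
    (l : List (Q × Q)) (hne : ∀ e ∈ l, e.1 ≠ e.2) (hl : l.Pairwise DisjointPairs)
    (hpair : ∀ e ∈ l, PairBound w w' e) (hV : IndependentGates V M l) :
    UncorrelatedOn μ (D ∪ pairSupport l) (fun v => conjPairs (V v) (M v) l) ∧
    ∀ P : Q → Fin 4, ∏ q, (if q ∈ pairSupport l then w' q else w q) (P q) ≤
      moment μ (fun v => conjPairs (V v) (M v) l) P P := by
  induction l with
  | nil => simpa [pairSupport, conjPairs] using ⟨hD, hle⟩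
  | cons e l ih =>
    rw [List.pairwise_cons] at hl
    obtain ⟨ih1, ih2⟩ := ih (fun e' he' => hne e' (List.mem_cons_of_mem _ he')) hl.2
      (fun e' he' => hpair e' (List.mem_cons_of_mem _ he')) hV.of_cons
    obtain ⟨i, hi, hMi, hVi⟩ := hV e List.mem_cons_self
    have hee : e.1 ≠ e.2 := hne e List.mem_cons_self
    have hel : ∀ e' ∈ l, e' ≠ e := by
      rintro e' he' rfl
      exact (hl.1 e' he').1 rfl
    have hS : IgnoresGate i fun v => conjPairs (V v) (M v) l :=
      hMi.conjPairs fun e' he' => hVi e' (List.mem_cons_of_mem _ he') (hel e' he')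
    have hc : Continuous fun v => conjPairs (V v) (M v) l := by
      refine continuous_conjPairs hM l fun e' he' => ?_
      obtain ⟨i', hi', -⟩ := hV e' (List.mem_cons_of_mem _ he')
      simp only [hi']
      exact continuous_subtype_val.comp (continuous_apply i')
    have hstep : (fun v => conjPairs (V v) (M v) (e :: l)) =
        fun v => onPair e (v i) * conjPairs (V v) (M v) l * (onPair e (v i))ᴴ := by
      funext v
      rw [conjPairs, hi]
    have hsupp : pairSupport (e :: l) = pairSupport l ∪ {e.1, e.2} := by
      ext q
      simp [pairSupport, or_assoc]
    -- By disjointness the gates in `l` have not touched the qubits of `e`, which thus still carry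
    -- the weights `w` that `PairBound` takes as input.
    have hfst : e.1 ∉ pairSupport l := by
      rintro ⟨e', he', h | h⟩
      · exact (hl.1 e' he').1 h
      · exact (hl.1 e' he').2.1 h
    have hsnd : e.2 ∉ pairSupport l := by
      rintro ⟨e', he', h | h⟩
      · exact (hl.1 e' he').2.2.1 h
      · exact (hl.1 e' he').2.2.2 h
    rw [hstep, hsupp]
    refine ⟨?_, prod_le_moment_onPair hS hc hee ?_ ?_ ?_ ih2⟩
    · rw [← Set.union_assoc]
      exact ih1.onPair hS hc hee
    · intro q p
      split_ifs
      · exact hw' q p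
      · exact hw q p
    · intro q h1 h2
      simp [h1, h2]
    · simpa [PairBound, hfst, hsnd] using hpair e List.mem_cons_self

end Moments

section Circuit

/-! ### The circuit as a function of its two-qubit gates -/

variable {N : ℕ} {σ : ℕ → LayerKind} {T : ℕ}

/-- The state of the system after a number of iterations with the two-qubit gates `V`. -/
def circuitState (σ : ℕ → LayerKind) (ρ₀ : Op (Fin N)) (V : ℕ → Qubit N × Qubit N → Op (Fin 2)) :
    ℕ → Op (Fin N)
  | 0 => ρ₀
  | t + 1 => traceAncillas
      (conjPairs (V t) (attachAncillas (circuitState σ ρ₀ V t)) (gates N (σ t)).toList)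

lemma outputState_eq_circuitState (σ : ℕ → LayerKind) (ρ₀ : Op (Fin N)) (θ : ℕ → LayerParams N)
    (t : ℕ) :
    outputState σ ρ₀ θ t = circuitState σ ρ₀ (fun t e => twoQubitGate (θ t e)) t := by
  induction t with
  | zero => rfl
  | succ t ih => rw [outputState, iteration_eq_conjPairs, ih, circuitState]

/-- The gates of the first `T` iterations, completed by identities. -/
def gateFamily (u : GateIndex N σ T → Op (Fin 2)) (t : ℕ) (e : Qubit N × Qubit N) : Op (Fin 2) :=
  if h : t < T ∧ e ∈ gates N (σ t) then u ⟨(t, e), h⟩ else 1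

lemma conjPairs_congr {Q : Type} [Fintype Q] [DecidableEq Q] {V V' : Q × Q → Op (Fin 2)}
    (M : Op Q) {l : List (Q × Q)} (h : ∀ e ∈ l, V e = V' e) :
    conjPairs V M l = conjPairs V' M l := by
  induction l with
  | nil => rfl
  | cons e l ih =>
    rw [conjPairs, conjPairs, h e List.mem_cons_self, ih fun e' he' => h e' (.tail _ he')]

lemma circuitState_congr (ρ₀ : Op (Fin N)) {V V' : ℕ → Qubit N × Qubit N → Op (Fin 2)} {t : ℕ}
    (h : ∀ s < t, ∀ e ∈ gates N (σ s), V s e = V' s e) :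
    circuitState σ ρ₀ V t = circuitState σ ρ₀ V' t := by
  induction t with
  | zero => rfl
  | succ t ih =>
    rw [circuitState, circuitState, ih fun s hs => h s (hs.trans t.lt_succ_self),
      conjPairs_congr _ fun e he => h t t.lt_succ_self e (Finset.mem_toList.mp he)]

lemma outputState_eq_gateFamily (σ : ℕ → LayerKind) (T : ℕ) (ρ₀ : Op (Fin N))
    (θ : ℕ → LayerParams N) :
    outputState σ ρ₀ θ T = circuitState σ ρ₀
      (gateFamily fun i : GateIndex N σ T => twoQubitGate (θ i.1.1 i.1.2)) T := by
  rw [outputState_eq_circuitState]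
  refine circuitState_congr ρ₀ fun s hs e he => ?_
  rw [gateFamily, dif_pos ⟨hs, he⟩]

lemma continuous_gateFamily (t : ℕ) (e : Qubit N × Qubit N) :
    Continuous fun u : GateIndex N σ T → Op (Fin 2) => gateFamily u t e := by
  unfold gateFamily
  split_ifs
  · exact continuous_apply _
  · exact continuous_const

lemma continuous_attachAncillas : Continuous (attachAncillas (N := N)) := by
  unfold attachAncillas
  refine continuous_matrix fun x y => ?_
  simp only [Matrix.of_apply]
  split_ifs
  · fun_prop
  · exact continuous_const

lemma continuous_traceAncillas : Continuous (traceAncillas (N := N)) := by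
  unfold traceAncillas
  refine continuous_matrix fun x y => ?_
  simp only [Matrix.of_apply]
  fun_prop

lemma continuous_circuitState (ρ₀ : Op (Fin N)) (t : ℕ) :
    Continuous fun u : GateIndex N σ T → Op (Fin 2) => circuitState σ ρ₀ (gateFamily u) t := by
  induction t with
  | zero => exact continuous_const
  | succ t ih =>
    exact continuous_traceAncillas.comp (continuous_conjPairs (continuous_attachAncillas.comp ih) _
      fun e _ => continuous_gateFamily t e)

/-- The gates as operators. -/
def gateOps (v : GateIndex N σ T → SU4) : GateIndex N σ T → Op (Fin 2) := fun i => v i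

lemma continuous_gateOps : Continuous (gateOps (N := N) (σ := σ) (T := T)) :=
  continuous_pi fun i => continuous_subtype_val.comp (continuous_apply i)

/-- The state after `t` iterations as a function of the gates in `SU(4)`. -/
def randomState (ρ₀ : Op (Fin N)) (t : ℕ) (v : GateIndex N σ T → SU4) : Op (Fin N) :=
  circuitState σ ρ₀ (gateFamily (gateOps v)) t

lemma continuous_randomState (ρ₀ : Op (Fin N)) (t : ℕ) :
    Continuous (randomState (σ := σ) (T := T) ρ₀ t) :=
  (continuous_circuitState ρ₀ t).comp continuous_gateOps

lemma gateFamily_mulSingle (i : GateIndex N σ T) (g : SU4) (v : GateIndex N σ T → SU4) {t : ℕ}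
    {e : Qubit N × Qubit N} (h : (t, e) ≠ i.1) :
    gateFamily (gateOps (Pi.mulSingle i g * v)) t e = gateFamily (gateOps v) t e := by
  unfold gateFamily
  split_ifs with h'
  · have : (⟨(t, e), h'⟩ : GateIndex N σ T) ≠ i := fun hc => h (congrArg Subtype.val hc)
    simp [gateOps, Pi.mulSingle_eq_of_ne this]
  · rfl

lemma ignoresGate_randomState (ρ₀ : Op (Fin N)) {t : ℕ} {i : GateIndex N σ T} (hi : t ≤ i.1.1) :
    IgnoresGate i (randomState (σ := σ) (T := T) ρ₀ t) := fun g v =>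
  circuitState_congr ρ₀ fun s hs e _ => gateFamily_mulSingle i g v fun h => by
    have : s = i.1.1 := congrArg Prod.fst h
    lia

lemma independentGates (ρ₀ : Op (Fin N)) {t : ℕ} (ht : t < T) :
    IndependentGates (fun v : GateIndex N σ T → SU4 => gateFamily (gateOps v) t)
      (fun v => attachAncillas (randomState ρ₀ t v)) (gates N (σ t)).toList := by
  intro e he
  have he' := Finset.mem_toList.mp he
  refine ⟨⟨(t, e), ht, he'⟩, fun v => dif_pos ⟨ht, he'⟩, fun g v => ?_, fun e' _ hne g v => ?_⟩
  · exact congrArg attachAncillas (ignoresGate_randomState ρ₀ le_rfl g v)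
  · exact gateFamily_mulSingle _ g v fun h => hne (congrArg Prod.snd h)

/-! ### Conservation of the trace. -/

lemma pauliExp_zero_eq_re_trace {Q : Type} [Fintype Q] [DecidableEq Q] (A : Op Q) :
    pauliExp 0 A = A.trace.re := by
  rw [pauliExp, pauliString_zero, one_mul]

lemma pauliExp_zero_conjPairs {Q : Type} [Fintype Q] [DecidableEq Q] {V : Q × Q → Op (Fin 2)}
    {l : List (Q × Q)} (hV : ∀ e ∈ l, e.1 ≠ e.2 ∧ (V e)ᴴ * V e = 1) (M : Op Q) :
    pauliExp 0 (conjPairs V M l) = pauliExp 0 M := by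
  induction l with
  | nil => rfl
  | cons e l ih =>
    obtain ⟨h1, h2⟩ := hV e List.mem_cons_self
    have hp : getPair e (0 : Q → Fin 4) = 0 := by
      ext i; fin_cases i <;> rfl
    have hs : setPair e (0 : Q → Fin 4) 0 = 0 := by
      conv_rhs => rw [← setPair_getPair e 0, hp]
    rw [conjPairs, pauliExp_onPair_conj h1, hp]
    simp only [transfer_zero_left h2]
    simp [hs, ih fun e' he' => hV e' (.tail _ he')]

lemma pauliExp_zero_randomState {ρ₀ : Op (Fin N)} (hρ₀ : ρ₀.trace = 1) {t : ℕ} (ht : t ≤ T)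
    (v : GateIndex N σ T → SU4) : pauliExp 0 (randomState ρ₀ t v) = 1 := by
  induction t with
  | zero => rw [pauliExp_zero_eq_re_trace, randomState, circuitState, hρ₀, Complex.one_re]
  | succ t ih =>
    have h0 : (Sum.elim 0 0 : Qubit N → Fin 4) = 0 := by
      ext q; rcases q with q | q <;> rfl
    rw [randomState, circuitState, pauliExp_traceAncillas, h0, pauliExp_zero_conjPairs,
      pauliExp_attachAncillas]
    · simpa using! ih (Nat.le_of_succ_le ht)
    · intro e he
      have he' := Finset.mem_toList.mp he
      refine ⟨gates_fst_ne_snd he', ?_⟩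
      rw [gateFamily, dif_pos ⟨ht, he'⟩]
      exact SU4.conjTranspose_mul_self _

/-! ### Second moments through the iterations -/

variable {μ : Measure (GateIndex N σ T → SU4)}

/-- The weight of a Pauli matrix: `1` for the identity and `a` otherwise. -/
def weight (a : ℝ) (p : Fin 4) : ℝ := if p = 0 then 1 else a

/-- The expectation of a Pauli matrix in the reset state. -/
def resetExp (p : Fin 4) : ℝ := if p = 0 ∨ p = 3 then 1 else 0

lemma weight_nonneg {a : ℝ} (ha : 0 ≤ a) (p : Fin 4) : 0 ≤ weight a p := by
  unfold weight; split_ifs <;> simp [ha]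

lemma resetExp_nonneg (p : Fin 4) : 0 ≤ resetExp p := by
  unfold resetExp; split_ifs <;> simp

lemma moment_attachAncillas (S : (GateIndex N σ T → SU4) → Op (Fin N)) (P P' : Qubit N → Fin 4) :
    moment μ (fun v => attachAncillas (S v)) P P' =
      moment μ S (fun j => P (.inl j)) (fun j => P' (.inl j)) *
        ((∏ j, resetExp (P (.inr j))) * ∏ j, resetExp (P' (.inr j))) := by
  rw [moment, moment, ← integral_mul_const]
  refine integral_congr_ae (Filter.Eventually.of_forall fun v => ?_)
  simp only [pauliExp_attachAncillas, resetExp]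
  ring

lemma moment_traceAncillas (S : (GateIndex N σ T → SU4) → Op (Qubit N)) (P P' : Fin N → Fin 4) :
    moment μ (fun v => traceAncillas (S v)) P P' = moment μ S (Sum.elim P 0) (Sum.elim P' 0) := by
  simp only [moment, pauliExp_traceAncillas]

/-- Distinct Pauli expectations are uncorrelated, and their second moments are bounded below in
terms of the weight of the string. -/
def MomentBound (μ : Measure (GateIndex N σ T → SU4)) (a : ℝ)
    (S : (GateIndex N σ T → SU4) → Op (Fin N)) : Prop :=
  UncorrelatedOn μ Set.univ S ∧ ∀ P, ∏ j, weight a (P j) ≤ moment μ S P P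

lemma sum_ne_zero_mul (u v : Fin 4 → ℝ) :
    ∑ q : Fin 2 → Fin 4 with q ≠ 0, u (q 0) * v (q 1) = (∑ i, u i) * (∑ i, v i) - u 0 * v 0 := by
  have h : ∑ q : Fin 2 → Fin 4, u (q 0) * v (q 1) = (∑ i, u i) * ∑ i, v i := by
    have := Finset.prod_univ_sum (fun _ : Fin 2 => (univ : Finset (Fin 4))) ![u, v]
    simpa [Fin.prod_univ_two] using this.symm
  rw [← h, Finset.filter_ne', ← Finset.add_sum_erase _ _ (mem_univ (0 : Fin 2 → Fin 4))]
  simp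

lemma prod_weight_zero_le (p : Fin N → Fin 4) :
    ∏ j, weight 0 (p j) ≤ (∏ j, resetExp (p j)) * ∏ j, resetExp (p j) := by
  rw [← Finset.prod_mul_distrib]
  refine Finset.prod_le_prod (fun j _ => weight_nonneg le_rfl _) fun j _ => ?_
  unfold weight resetExp
  by_cases h : p j = 0 <;> by_cases h' : p j = 3 <;> simp [h, h']

lemma gates_pairwise (κ : LayerKind) : (gates N κ).toList.Pairwise DisjointPairs :=
  (Finset.nodup_toList _).imp_of_mem fun ha hb hab =>
    gates_disjoint (Finset.mem_toList.mp ha) (Finset.mem_toList.mp hb) hab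

variable [IsProbabilityMeasure μ] [μ.IsMulLeftInvariant]

/-- A layer of gates between system qubits. -/
lemma MomentBound.system_layer {ρ₀ : Op (Fin N)} {t : ℕ} (ht : t < T) (hσ : σ t ≠ .ancilla)
    {a : ℝ} (ha : 0 ≤ a) (ha1 : a ≤ 1)
    (h : MomentBound μ a (randomState (σ := σ) (T := T) ρ₀ t)) :
    MomentBound μ (a / 5) (randomState (σ := σ) (T := T) ρ₀ (t + 1)) := by
  classical
  set w : ℝ → Qubit N → Fin 4 → ℝ := fun b => Sum.elim (fun _ => weight b) (fun _ => weight 0)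
    with hw
  have hw0 : ∀ b : ℝ, 0 ≤ b → ∀ q p, 0 ≤ w b q p := by
    rintro b hb (q | q) p
    · exact weight_nonneg hb p
    · exact weight_nonneg le_rfl p
  have hpair : ∀ e ∈ (gates N (σ t)).toList, PairBound (w a) (w (a / 5)) e := by
    intro e he
    have hsys : ∃ j j', e = (Sum.inl j, Sum.inl j') := by
      have he' := Finset.mem_toList.mp he
      revert hσ he'
      cases σ t
      · simp
      all_goals
        simp only [gates, mem_image]
        rintro - ⟨p, -, rfl⟩
        exact ⟨p.1, p.2, rfl⟩
    obtain ⟨j, j', rfl⟩ := hsys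
    refine ⟨by simp [hw, weight], fun p hp => ?_⟩
    simp only [hw, Sum.elim_inl, sum_ne_zero_mul]
    have hp' : ¬ (p 0 = 0 ∧ p 1 = 0) := fun h0 => hp (by
      ext i; fin_cases i <;> simp [h0.1, h0.2])
    -- At least one factor is a/5, and the other is at most 1.
    have h1 : weight (a / 5) (p 0) * weight (a / 5) (p 1) ≤ a / 5 := by
      unfold weight
      split_ifs with h1 h2 h2
      · exact absurd ⟨h1, h2⟩ hp'
      all_goals nlinarith
    refine h1.trans ?_
    -- The mean input weight is ((1 + 3a)² - 1)/15 = (6a + 9a²)/15, which is at least a/5.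
    simp [weight, Fin.sum_univ_four]
    nlinarith
  have hD : UncorrelatedOn μ (Set.range Sum.inl) fun v => attachAncillas (randomState (σ := σ) (T := T) ρ₀ t v) := by
    rintro P P' ⟨_, ⟨j, rfl⟩, hj⟩
    refine (moment_attachAncillas _ P P').trans ?_
    rw [h.1 _ _ ⟨j, trivial, hj⟩, zero_mul]
  have hle : ∀ P, ∏ q, w a q (P q) ≤
      moment μ (fun v => attachAncillas (randomState (σ := σ) (T := T) ρ₀ t v)) P P := by
    intro P
    refine le_trans ?_ (moment_attachAncillas _ P P).ge
    rw [Fintype.prod_sum_type]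
    exact mul_le_mul (h.2 _) (prod_weight_zero_le _)
      (Finset.prod_nonneg fun j _ => weight_nonneg le_rfl _) (moment_self_nonneg _ _)
  obtain ⟨h1, h2⟩ := moment_conjPairs (μ := μ) (D := Set.range Sum.inl) (w := w a)
    (w' := w (a / 5))
    (continuous_attachAncillas.comp (continuous_randomState ρ₀ t)) hD (hw0 a ha)
    (hw0 (a / 5) (by positivity)) hle (gates N (σ t)).toList
    (fun e he => gates_fst_ne_snd (Finset.mem_toList.mp he)) (gates_pairwise _) hpair
    (independentGates ρ₀ ht)
  refine ⟨fun P P' hPP' => ?_, fun P => ?_⟩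
  · obtain ⟨j, -, hj⟩ := hPP'
    refine (moment_traceAncillas _ P P').trans (h1 _ _ ⟨Sum.inl j, Or.inl ⟨j, rfl⟩, hj⟩)
  · refine le_trans ?_ ((h2 (Sum.elim P 0)).trans_eq (moment_traceAncillas _ P P).symm)
    rw [Fintype.prod_sum_type]
    -- The discarded ancillas carry the identity, which has weight 1.
    have hr : ∏ j : Fin N, (if (Sum.inr j : Qubit N) ∈ pairSupport (gates N (σ t)).toList then
        w (a / 5) (Sum.inr j) else w a (Sum.inr j)) ((Sum.elim P 0 : Qubit N → Fin 4) (Sum.inr j)) = 1 :=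
      Finset.prod_eq_one fun j _ => by split_ifs <;> simp [hw, weight]
    rw [hr, mul_one]
    refine Finset.prod_le_prod (fun j _ => weight_nonneg (by positivity) _) fun j _ => ?_
    -- A qubit at the end of the line may have no gate in this layer; it keeps the larger weight
    -- `a`.
    split_ifs
    · exact le_rfl
    · simp only [hw, Sum.elim_inl, weight]
      split_ifs
      · exact le_rfl
      · linarith

/-- A layer of gates between system qubits and ancillas. -/
lemma momentBound_ancilla_layer {ρ₀ : Op (Fin N)} (hρ₀ : ρ₀.trace = 1) {t : ℕ} (ht : t < T)
    (hσ : σ t = .ancilla) :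
    MomentBound μ (1 / 15) (randomState (σ := σ) (T := T) ρ₀ (t + 1)) := by
  classical
  set w : Qubit N → Fin 4 → ℝ := Sum.elim (fun _ => weight 0) (fun _ => resetExp) with hw
  set w' : Qubit N → Fin 4 → ℝ := Sum.elim (fun _ => weight (1 / 15)) (fun _ => weight 0) with hw'
  have hw0 : ∀ q p, 0 ≤ w q p := by
    rintro (q | q) p
    · exact weight_nonneg le_rfl p
    · exact resetExp_nonneg p
  have hw0' : ∀ q p, 0 ≤ w' q p := by
    rintro (q | q) p
    · exact weight_nonneg (by norm_num) p
    · exact weight_nonneg le_rfl p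
  have hpair : ∀ e ∈ (gates N (σ t)).toList, PairBound w w' e := by
    intro e he
    rw [Finset.mem_toList, hσ, gates, mem_image] at he
    obtain ⟨j, -, rfl⟩ := he
    refine ⟨by simp [hw, hw', weight, resetExp], fun p hp => ?_⟩
    simp only [hw, hw', Sum.elim_inl, Sum.elim_inr, sum_ne_zero_mul]
    have hp' : ¬ (p 0 = 0 ∧ p 1 = 0) := fun h0 => hp (by
      ext i; fin_cases i <;> simp [h0.1, h0.2])
    -- The output weight vanishes unless the ancilla carries the identity, which is all that the
    -- partial trace sees; then the system qubit is nontrivial.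
    have h1 : weight (1 / 15) (p 0) * weight 0 (p 1) ≤ 1 / 15 := by
      unfold weight
      split_ifs with h1 h2 h2
      · exact absurd ⟨h1, h2⟩ hp'
      all_goals norm_num
    refine h1.trans ?_
    -- The two contributions are I and Z on the ancilla. Removing the trivial string of the pair
    -- leaves I⊗Z alone, hence a mean of 1/15.
    have h2 : ∑ i, resetExp i = 2 := by
      simp only [Fin.sum_univ_four, resetExp]
      norm_num [Fin.ext_iff]
    rw [h2]
    norm_num [weight, resetExp]
  have hsupp : ∀ q, q ∈ pairSupport (gates N (σ t)).toList := by
    intro q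
    have hg : ∀ j : Fin N, ((Sum.inl j, Sum.inr j) : Qubit N × Qubit N) ∈ (gates N (σ t)).toList := by
      intro j
      rw [Finset.mem_toList, hσ]
      exact Finset.mem_image_of_mem _ (mem_univ j)
    rcases q with j | j
    · exact ⟨_, hg j, Or.inl rfl⟩
    · exact ⟨_, hg j, Or.inr rfl⟩
  have hD : UncorrelatedOn μ ∅ fun v => attachAncillas (randomState (σ := σ) (T := T) ρ₀ t v) := by
    rintro P P' ⟨_, h, _⟩
    exact h.elim
  have hle : ∀ P, ∏ q, w q (P q) ≤
      moment μ (fun v => attachAncillas (randomState (σ := σ) (T := T) ρ₀ t v)) P P := by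
    intro P
    refine le_trans ?_ (moment_attachAncillas _ P P).ge
    rw [Fintype.prod_sum_type]
    refine mul_le_mul ?_ ?_ (Finset.prod_nonneg fun j _ => resetExp_nonneg _)
      (moment_self_nonneg _ _)
    -- Nothing is known about the incoming state except its trace, so only the identity string gets
    -- a positive bound.
    · by_cases hP : (fun j => P (Sum.inl j)) = 0
      · rw [hP]
        have : moment μ (randomState (σ := σ) (T := T) ρ₀ t) 0 0 = 1 := by
          simp [moment, pauliExp_zero_randomState hρ₀ ht.le]
        rw [this]
        exact Finset.prod_le_one (fun j _ => weight_nonneg le_rfl _) fun j _ => by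
          simp only [hw, Sum.elim_inl, weight]; split_ifs <;> norm_num
      · obtain ⟨j, hj⟩ := Function.ne_iff.mp hP
        rw [Finset.prod_eq_zero (mem_univ j)]
        · exact moment_self_nonneg _ _
        · exact if_neg hj
    · rw [← Finset.prod_mul_distrib]
      refine (Finset.prod_congr rfl fun j _ => ?_).le
      simp only [hw, Sum.elim_inr, resetExp]
      split_ifs <;> simp
  obtain ⟨h1, h2⟩ := moment_conjPairs (μ := μ) (D := ∅) (w := w) (w' := w')
    (continuous_attachAncillas.comp (continuous_randomState ρ₀ t)) hD hw0
    hw0' hle (gates N (σ t)).toList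
    (fun e he => gates_fst_ne_snd (Finset.mem_toList.mp he)) (gates_pairwise _) hpair
    (independentGates ρ₀ ht)
  refine ⟨fun P P' hPP' => ?_, fun P => ?_⟩
  · obtain ⟨j, -, hj⟩ := hPP'
    refine (moment_traceAncillas _ P P').trans (h1 _ _ ⟨Sum.inl j, Or.inr (hsupp _), hj⟩)
  · refine le_trans ?_ ((h2 (Sum.elim P 0)).trans_eq (moment_traceAncillas _ P P).symm)
    simp only [hsupp, if_true]
    rw [Fintype.prod_sum_type]
    simp [hw', weight]

/-- The bound at the end of the circuit, `d` layers after the last ancilla layer. -/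
lemma momentBound_randomState {ρ₀ : Op (Fin N)} (hρ₀ : ρ₀.trace = 1) {t : ℕ}
    (hσ : σ t = .ancilla) (d : ℕ) (hd : t + d < T) (hlast : ∀ s, t < s → s ≤ t + d → σ s ≠ .ancilla) :
    MomentBound μ (1 / 15 / 5 ^ d) (randomState (σ := σ) (T := T) ρ₀ (t + d + 1)) := by
  induction d with
  | zero => simpa using momentBound_ancilla_layer hρ₀ hd hσ
  | succ d ih =>
    rw [pow_succ, ← div_div]
    refine (ih (by lia) fun s h1 h2 => hlast s h1 (by lia)).system_layer (t := t + d + 1)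
      (by lia) (hlast _ (by lia) (by lia)) (by positivity) ?_
    rw [div_div]
    refine div_le_one_of_le₀ ?_ (by positivity)
    have : (1 : ℝ) ≤ 5 ^ d := one_le_pow₀ (by norm_num)
    linarith

end Circuit

open ProbabilityTheory

section Hamiltonian

/-! ### Local Hamiltonians in the Pauli basis -/

variable {Q : Type} [Fintype Q] [DecidableEq Q]

lemma IsLocalHamiltonian.isHermitian {k : ℕ} {H : Op Q} (hH : IsLocalHamiltonian k H) :
    H.IsHermitian := by
  obtain ⟨h, hh, rfl⟩ := hH
  rw [Matrix.IsHermitian, Matrix.conjTranspose_sum]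
  exact Finset.sum_congr rfl fun S hS => (hh S (Finset.mem_filter.mp hS).2).1

lemma pauliExp_sum {ι : Type} (s : Q → Fin 4) (S : Finset ι) (A : ι → Op Q) :
    pauliExp s (∑ i ∈ S, A i) = ∑ i ∈ S, pauliExp s (A i) := by
  simp [pauliExp, Matrix.mul_sum, Matrix.trace_sum]

/-- Pauli strings of weight larger than `k` do not occur in a `k`-local Hamiltonian. -/
lemma IsLocalHamiltonian.pauliCoeff_eq_zero {k : ℕ} {H : Op Q} (hH : IsLocalHamiltonian k H)
    {s : Q → Fin 4} (hs : k < #{q | s q ≠ 0}) : pauliCoeff s H = 0 := by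
  obtain ⟨h, hh, rfl⟩ := hH
  rw [pauliCoeff, pauliExp_sum, Finset.sum_div]
  refine Finset.sum_eq_zero fun S hS => ?_
  have hSk := (Finset.mem_filter.mp hS).2
  refine (hh S hSk).2.pauliCoeff_eq_zero ?_
  by_contra hc
  push Not at hc
  have : ({q | s q ≠ 0} : Finset Q) ⊆ S := fun q hq => by
    by_contra hqS
    exact (Finset.mem_filter.mp hq).2 (hc q hqS)
  exact absurd (Finset.card_le_card this) (by lia)

lemma tracelessPart_isHermitian {H : Op Q} (hH : H.IsHermitian) :
    (tracelessPart H).IsHermitian := by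
  unfold tracelessPart
  refine hH.sub ?_
  have h : H.trace = ((pauliExp 0 H : ℝ) : ℂ) := by
    rw [← trace_pauliString_mul_of_isHermitian 0 hH, pauliString_zero, one_mul]
  rw [Matrix.IsHermitian, Matrix.conjTranspose_smul, Matrix.conjTranspose_one, h]
  congr 1
  simp

lemma pauliCoeff_tracelessPart (s : Q → Fin 4) {H : Op Q} (hH : H.IsHermitian) :
    pauliCoeff s (tracelessPart H) = if s = 0 then 0 else pauliCoeff s H := by
  have h : pauliExp s (tracelessPart H) =
      pauliExp s H - ((H.trace / 2 ^ Fintype.card Q) * (pauliString s).trace).re := by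
    simp [pauliExp, tracelessPart, mul_sub]
  have h0 : H.trace = ((pauliExp 0 H : ℝ) : ℂ) := by
    rw [← trace_pauliString_mul_of_isHermitian 0 hH, pauliString_zero, one_mul]
  rw [pauliCoeff, h, trace_pauliString]
  split_ifs with hs
  · rw [hs, div_mul_cancel₀ _ (pow_ne_zero _ two_ne_zero), h0, Complex.ofReal_re, sub_self, zero_div]
  · simp [pauliCoeff]

lemma hsNorm_sq_eq_sum {A : Op Q} (hA : A.IsHermitian) :
    hsNorm A ^ 2 = ∑ s, pauliCoeff s A ^ 2 := by
  have h : (Aᴴ * A).trace.re / 2 ^ Fintype.card Q = ∑ s, pauliCoeff s A ^ 2 := by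
    rw [hA.eq, re_trace_mul_eq_sum hA, Finset.sum_div]
    exact Finset.sum_congr rfl fun s _ => by rw [sq, pauliCoeff, mul_div_assoc]
  rw [hsNorm, h, Real.sq_sqrt (Finset.sum_nonneg fun _ _ => sq_nonneg _)]

lemma hsNorm_tracelessPart_sq {H : Op Q} (hH : H.IsHermitian) :
    hsNorm (tracelessPart H) ^ 2 = ∑ s with s ≠ 0, pauliCoeff s H ^ 2 := by
  rw [hsNorm_sq_eq_sum (tracelessPart_isHermitian hH), Finset.sum_filter]
  refine Finset.sum_congr rfl fun s _ => ?_
  rw [pauliCoeff_tracelessPart s hH]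
  split_ifs <;> simp_all

end Hamiltonian

section Variance

/-! ### The variance of the energy -/

variable {N : ℕ} {σ : ℕ → LayerKind} {T : ℕ} {μ : Measure (GateIndex N σ T → SU4)}

lemma prod_weight_eq_pow (a : ℝ) (P : Fin N → Fin 4) :
    ∏ j, weight a (P j) = a ^ #{j | P j ≠ 0} := by
  simp [weight, Finset.prod_ite]

lemma pow_mul_hsNorm_le_variance [IsProbabilityMeasure μ] {k : ℕ} {H : Op (Fin N)}
    (hH : IsLocalHamiltonian k H) {a : ℝ} (ha : 0 ≤ a) (ha1 : a ≤ 1)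
    {S : (GateIndex N σ T → SU4) → Op (Fin N)} (hc : Continuous S)
    (h0 : ∀ v, pauliExp 0 (S v) = 1) (hS : MomentBound μ a S) :
    a ^ k * hsNorm (tracelessPart H) ^ 2 ≤ variance (fun v => (H * S v).trace.re) μ := by
  have hHH := hH.isHermitian
  set c : (Fin N → Fin 4) → ℝ := fun P => pauliCoeff P H with hcdef
  have hcexp : ∀ P, Continuous fun v => pauliExp P (S v) := fun P =>
    (continuous_pauliExp P).comp hc
  have hsplit : ∀ v, (H * S v).trace.re = c 0 + ∑ P with P ≠ 0, c P * pauliExp P (S v) := by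
    intro v
    rw [re_trace_mul_eq_sum hHH, Finset.filter_ne',
      ← Finset.add_sum_erase _ _ (mem_univ (0 : Fin N → Fin 4)), h0, mul_one]
  -- The identity string has constant expectation 1, so being uncorrelated with it means having mean
  -- zero.
  have hmean : ∀ P : Fin N → Fin 4, P ≠ 0 → ∫ v, pauliExp P (S v) ∂μ = 0 := by
    intro P hP
    obtain ⟨j, hj⟩ := Function.ne_iff.mp hP
    have := hS.1 P 0 ⟨j, trivial, hj⟩
    simpa [moment, h0] using this
  have hint : ∀ P, Integrable (fun v => c P * pauliExp P (S v)) μ := fun P =>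
    integrable_of_continuous (continuous_const.mul (hcexp P))
  have hE : ∫ v, (H * S v).trace.re ∂μ = c 0 := by
    simp only [hsplit]
    rw [integral_add (integrable_const _) (integrable_finsetSum _ fun P _ => hint P),
      integral_finsetSum _ fun P _ => hint P, Finset.sum_eq_zero]
    · simp
    · intro P hP
      rw [integral_const_mul, hmean P (Finset.mem_filter.mp hP).2, mul_zero]
  have hcF : Continuous fun v => (H * S v).trace.re := by fun_prop
  rw [variance_eq_integral hcF.measurable.aemeasurable, hE]
  have hsq : ∀ v, ((H * S v).trace.re - c 0) ^ 2 = ∑ P with P ≠ 0, ∑ P' with P' ≠ 0,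
      c P * c P' * (pauliExp P (S v) * pauliExp P' (S v)) := by
    intro v
    rw [hsplit, add_sub_cancel_left, sq, Finset.sum_mul_sum]
    exact Finset.sum_congr rfl fun P _ => Finset.sum_congr rfl fun P' _ => by ring
  have hint2 : ∀ P P', Integrable (fun v => c P * c P' * (pauliExp P (S v) * pauliExp P' (S v))) μ :=
    fun P P' => integrable_of_continuous (continuous_const.mul ((hcexp P).mul (hcexp P')))
  have hvar : ∫ v, ((H * S v).trace.re - c 0) ^ 2 ∂μ =
      ∑ P with P ≠ 0, c P ^ 2 * moment μ S P P := by
    simp only [hsq]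
    rw [integral_finsetSum _ fun P _ => integrable_finsetSum _ fun P' _ => hint2 P P']
    refine Finset.sum_congr rfl fun P hP => ?_
    rw [integral_finsetSum _ fun P' _ => hint2 P P', Finset.sum_eq_single_of_mem P hP]
    · rw [integral_const_mul, sq]; rfl
    · intro P' _ hne
      obtain ⟨j, hj⟩ := Function.ne_iff.mp hne.symm
      rw [integral_const_mul]
      exact mul_eq_zero_of_right _ (hS.1 P P' ⟨j, trivial, hj⟩)
  rw [hvar, hsNorm_tracelessPart_sq hHH, Finset.mul_sum]
  refine Finset.sum_le_sum fun P _ => ?_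
  -- Strings heavier than `k` have coefficient 0; for the others a^|P| ≥ a^k because a ≤ 1.
  by_cases hk : k < #{j | P j ≠ 0}
  · simp [hcdef, hH.pauliCoeff_eq_zero hk]
  · rw [mul_comm]
    refine mul_le_mul_of_nonneg_left ?_ (sq_nonneg _)
    refine le_trans ?_ (hS.2 P)
    rw [prod_weight_eq_pow]
    exact pow_le_pow_of_le_one ha ha1 (not_lt.mp hk)

/-! ### The product Haar law of the gates. -/

instance : Finite (GateIndex N σ T) := by
  have : ({i : ℕ × (Qubit N × Qubit N) | i.1 < T ∧ i.2 ∈ gates N (σ i.1)}).Finite :=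
    ((Set.finite_Iio T).prod Set.finite_univ).subset fun i hi => ⟨hi.1, trivial⟩
  exact this.to_subtype

instance : Fintype (GateIndex N σ T) := Fintype.ofFinite _

instance : IsProbabilityMeasure haarSU4 := ⟨Measure.haarMeasure_self⟩

instance : haarSU4.IsMulLeftInvariant := by
  unfold haarSU4
  infer_instance

/-- The joint law of the gates of the circuit. -/
def gateLaw (N : ℕ) (σ : ℕ → LayerKind) (T : ℕ) : Measure (GateIndex N σ T → SU4) :=
  Measure.pi fun _ => haarSU4

instance : IsProbabilityMeasure (gateLaw N σ T) := by
  unfold gateLaw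
  infer_instance

instance : (gateLaw N σ T).IsMulLeftInvariant := by
  unfold gateLaw
  infer_instance

/-- The energy of Haar random parameters has the variance computed in `SU(4)`. -/
lemma IsHaarRandom.variance_energy {Ω : Type*} [MeasurableSpace Ω] {P : Measure Ω}
    [IsProbabilityMeasure P] {θ : Ω → ℕ → LayerParams N} (hθ : IsHaarRandom P σ T θ)
    (ρ₀ H : Op (Fin N)) :
    variance (fun ω => energy σ T ρ₀ H (θ ω)) P =
      variance (fun v => (H * randomState ρ₀ T v).trace.re) (gateLaw N σ T) := by
  set F : (GateIndex N σ T → Op (Fin 2)) → ℝ := fun u =>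
    (H * circuitState σ ρ₀ (gateFamily u) T).trace.re with hF
  set Y : Ω → GateIndex N σ T → Op (Fin 2) := fun ω i => twoQubitGate (θ ω i.1.1 i.1.2) with hY
  have hFm : Measurable F := by
    have h := continuous_circuitState (σ := σ) (T := T) ρ₀ T
    have : Continuous F := by
      simp only [hF]
      fun_prop
    exact this.measurable
  have hYm : AEMeasurable Y P := aemeasurable_pi_lambda _ fun i => (hθ.haar i).aemeasurable
  -- Independence makes the joint law the product of its marginals, which is the image of the
  -- product Haar measure.
  have hlaw : P.map Y = (gateLaw N σ T).map gateOps := by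
    have h1 := (iIndepFun_iff_map_fun_eq_pi_map fun i => (hθ.haar i).aemeasurable).mp hθ.indep
    have h2 : Measurable (Subtype.val : SU4 → Op (Fin 2)) := measurable_subtype_coe
    have : IsProbabilityMeasure (haarSU4.map (Subtype.val : SU4 → Op (Fin 2))) :=
      Measure.isProbabilityMeasure_map h2.aemeasurable
    refine h1.trans ?_
    rw [funext fun i => (hθ.haar i).map_eq, gateLaw]
    exact (Measure.pi_map_pi fun _ => h2.aemeasurable).symm
  have henergy : (fun ω => energy σ T ρ₀ H (θ ω)) = F ∘ Y := by
    funext ω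
    simp only [energy, outputState_eq_gateFamily, hF, hY, Function.comp_apply]
  rw [henergy, ← variance_map hFm.aemeasurable hYm, hlaw,
    variance_map hFm.aemeasurable continuous_gateOps.measurable.aemeasurable]
  rfl

end Variance

section Distance

/-! ### The distance to the nearest reset -/

variable {N : ℕ} {σ : ℕ → LayerKind} {T : ℕ}

lemma subset_backward (κ : LayerKind) (C : Finset (Qubit N)) : C ⊆ backward κ C :=
  Finset.subset_union_left

lemma inl_mem_lightCone (σ : ℕ → LayerKind) (T : ℕ) (j : Fin N) (d : ℕ) :
    Sum.inl j ∈ lightCone σ T j d := by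
  induction d with
  | zero => simp [lightCone]
  | succ d ih =>
    rw [lightCone, Finset.mem_filter]
    exact ⟨subset_backward _ _ ih, rfl⟩

lemma inr_notMem_lightCone (σ : ℕ → LayerKind) (T : ℕ) (j a : Fin N) (d : ℕ) :
    Sum.inr a ∉ lightCone σ T j d := by
  cases d <;> simp [lightCone]

lemma inr_mem_backward_ancilla {C : Finset (Qubit N)} {j : Fin N} (h : Sum.inl j ∈ C) :
    Sum.inr j ∈ backward .ancilla C := by
  simp only [backward, gates, mem_union, mem_biUnion, mem_filter, mem_image]
  exact Or.inr ⟨(Sum.inl j, Sum.inr j), ⟨⟨j, mem_univ j, rfl⟩, Or.inl h⟩, by simp⟩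

lemma inr_notMem_backward {κ : LayerKind} (hκ : κ ≠ .ancilla) {C : Finset (Qubit N)} {a : Fin N}
    (h : Sum.inr a ∉ C) : Sum.inr a ∉ backward κ C := by
  cases κ
  · exact absurd rfl hκ
  all_goals simp [backward, gates, h]

/-- A light cone always contains its own system qubit, so the last ancilla layer reaches a reset;
the layers after it couple no ancilla. The value is therefore the same for all `j`. An ancilla layer
must exist, since `sInf ∅ = 0`. -/
lemma resetDistance_eq {d : ℕ} (hd : d < T) (hσ : σ (T - 1 - d) = .ancilla)
    (hlast : ∀ d' < d, σ (T - 1 - d') ≠ .ancilla) (j : Fin N) : resetDistance σ T j = d + 1 := by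
  refine le_antisymm (Nat.sInf_le ⟨d, hd, rfl, j, ?_⟩) (le_csInf ⟨d + 1, d, hd, rfl, j, ?_⟩ ?_)
  · rw [hσ]
    exact inr_mem_backward_ancilla (inl_mem_lightCone σ T j d)
  · rw [hσ]
    exact inr_mem_backward_ancilla (inl_mem_lightCone σ T j d)
  · rintro _ ⟨d', -, rfl, a, ha⟩
    by_contra hlt
    exact inr_notMem_backward (hlast d' (by lia)) (inr_notMem_lightCone σ T j a d') ha

/-- Three consecutive layers are of different kinds, and there are only three kinds, so one of the
last three is an ancilla layer once T ≥ 3. For smaller T the bound d < T is enough. -/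
lemma exists_last_ancilla (hσ : IsRotation σ) (hT : ∃ t < T, σ t = .ancilla) :
    ∃ d ≤ 2, d < T ∧ σ (T - 1 - d) = .ancilla ∧ ∀ d' < d, σ (T - 1 - d') ≠ .ancilla := by
  classical
  have hex : ∃ d, d < T ∧ σ (T - 1 - d) = .ancilla := by
    obtain ⟨t, ht, h⟩ := hT
    refine ⟨T - 1 - t, by lia, ?_⟩
    rwa [show T - 1 - (T - 1 - t) = t by lia]
  obtain ⟨h1, h2⟩ := Nat.find_spec hex
  have hlast : ∀ d' < Nat.find hex, σ (T - 1 - d') ≠ .ancilla := fun d' hd' h =>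
    Nat.find_min hex hd' ⟨hd'.trans h1, h⟩
  refine ⟨Nat.find hex, ?_, h1, h2, hlast⟩
  by_contra! hlt
  have ha := hlast 0 (by lia)
  have hb := hlast 1 (by lia)
  have hc := hlast 2 (by lia)
  have key : ∀ x y z : LayerKind, x ≠ .ancilla → y ≠ .ancilla → z ≠ .ancilla →
      ¬ (z ≠ y ∧ y ≠ x ∧ z ≠ x) := by
    rintro (_ | _ | _) (_ | _ | _) (_ | _ | _) <;> simp
  -- The search index exceeds 2 and is below `T`, so the truncated subtractions are genuine.
  have hrot := hσ (T - 1 - 2)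
  rw [show T - 1 - 2 + 1 = T - 1 - 1 by lia, show T - 1 - 2 + 2 = T - 1 - 0 by lia] at hrot
  exact key _ _ _ ha hb hc hrot

end Distance

end SSGD

end

/-! ### The variance bound. -/

theorem mainTheorem2 {Ω : Type*} [MeasurableSpace Ω] (P : MeasureTheory.Measure Ω)
    [MeasureTheory.IsProbabilityMeasure P] (N k T : ℕ)
    (σ : ℕ → SSGD.LayerKind) (hσ : SSGD.IsRotation σ)
    (hT : ∃ t < T, σ t = SSGD.LayerKind.ancilla)
    (ρ₀ : SSGD.Op (Fin N)) (hρ₀ : SSGD.IsDensity ρ₀)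
    (H : SSGD.Op (Fin N)) (hH : SSGD.IsLocalHamiltonian k H)
    (θ : Ω → ℕ → SSGD.LayerParams N) (hθ : SSGD.IsHaarRandom P σ T θ) :
    SSGD.feedforwardDistance N σ T ≤ 5 ∧
    SSGD.hsNorm (SSGD.tracelessPart H) ^ 2 / 5 ^ (k * (SSGD.feedforwardDistance N σ T + 1)) ≤
      ProbabilityTheory.variance (fun ω => SSGD.energy σ T ρ₀ H (θ ω)) P ∧
    SSGD.hsNorm (SSGD.tracelessPart H) ^ 2 / 5 ^ (6 * k) ≤
      ProbabilityTheory.variance (fun ω => SSGD.energy σ T ρ₀ H (θ ω)) P := by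
  obtain ⟨d, hd2, hdT, hanc, hlast⟩ := SSGD.exists_last_ancilla hσ hT
  have hf5 : SSGD.feedforwardDistance N σ T ≤ 5 := Finset.sup_le fun j _ => by
    rw [SSGD.resetDistance_eq hdT hanc hlast]
    lia
  have hvar : SSGD.hsNorm (SSGD.tracelessPart H) ^ 2 /
      5 ^ (k * (SSGD.feedforwardDistance N σ T + 1)) ≤
      ProbabilityTheory.variance (fun ω => SSGD.energy σ T ρ₀ H (θ ω)) P := by
    -- Without qubits the supremum defining f is 0 rather than d + 1, but then the traceless part
    -- vanishes.
    rcases Nat.eq_zero_or_pos N with rfl | hN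
    · have h0 : SSGD.hsNorm (SSGD.tracelessPart H) ^ 2 = 0 := by
        rw [SSGD.hsNorm_tracelessPart_sq hH.isHermitian]
        exact Finset.sum_eq_zero fun s hs =>
          absurd (Subsingleton.elim s 0) (Finset.mem_filter.mp hs).2
      rw [h0, zero_div]
      exact ProbabilityTheory.variance_nonneg _ _
    · have hf : d + 1 ≤ SSGD.feedforwardDistance N σ T := by
        rw [← SSGD.resetDistance_eq hdT hanc hlast (⟨0, hN⟩ : Fin N)]
        exact Finset.le_sup (f := fun j : Fin N => SSGD.resetDistance σ T j) (Finset.mem_univ _)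
      have hb := SSGD.momentBound_randomState (μ := SSGD.gateLaw N σ T) hρ₀.2 hanc d (by lia)
        fun s h1 h2 => by
          have := hlast (T - 1 - s) (by lia)
          rwa [show T - 1 - (T - 1 - s) = s by lia] at this
      rw [show T - 1 - d + d + 1 = T by lia] at hb
      have h5 : (1 : ℝ) ≤ 5 ^ d := one_le_pow₀ (by norm_num)
      have ha1 : (1 : ℝ) / 15 / 5 ^ d ≤ 1 := by
        rw [div_div]
        exact div_le_one_of_le₀ (by linarith) (by positivity)
      have hmain := SSGD.pow_mul_hsNorm_le_variance hH (by positivity) ha1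
        (SSGD.continuous_randomState ρ₀ T) (SSGD.pauliExp_zero_randomState hρ₀.2 le_rfl) hb
      rw [hθ.variance_energy]
      refine le_trans ?_ hmain
      rw [div_eq_inv_mul]
      refine mul_le_mul_of_nonneg_right ?_ (sq_nonneg _)
      rw [mul_comm k, pow_mul, ← inv_pow]
      refine pow_le_pow_left₀ (by positivity) ?_ k
      rw [div_div, one_div]
      refine inv_anti₀ (by positivity) ?_
      -- The ancilla layer's 15 is rounded up to 5², which is the origin of the exponent f + 1 with
      -- f = d + 1.
      calc (15 : ℝ) * 5 ^ d ≤ 5 ^ (d + 2) := by rw [pow_add]; linarith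
        _ ≤ _ := pow_le_pow_right₀ (by norm_num) (by lia)
  refine ⟨hf5, hvar, le_trans ?_ hvar⟩
  refine div_le_div_of_nonneg_left (sq_nonneg _) (by positivity) ?_
  refine pow_le_pow_right₀ (by norm_num) ?_
  rw [mul_comm k]
  exact Nat.mul_le_mul_right k (by lia)
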